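/- Fix $q\in(0,1)$, $\nu\in[0,1)$, $R,L\ge 0$ and an integer $k\ge 0$. For integers $1\le j\le m$ put $$\phi^R(j|m)=R\,\frac{\nu^{j-1}}{[j]_q}\,\frac{(\nu;q)_{m-j}}{(\nu;q)_m}\,\frac{(q;q)_m}{(q;q)_{m-j}},\qquad \phi^L(j|m)=L\,\frac{1}{[j]_q}\,\frac{(\nu;q)_{m-j}}{(\nu;q)_m}\,\frac{(q;q)_m}{(q;q)_{m-j}},$$ where $(a;q)_n=\prod_{i=0}^{n-1}(1-aq^i)$, $[j]_q=1+q+\dots+q^{j-1}$, $0^0=1$, and let $\phi^R(j|\infty)=\lim_{m\to\infty}\phi^R(j|m)=R\,\nu^{j-1}/[j]_q$. Let $\mathbb X^\infty$ be the set of sequences $+\infty=x_0>x_1>x_2>\cdots$ with $x_n\in\mathbb Z$ for $n\ge 1$ and $x_n-x_{n+1}=1$ for all large $n$. The $q$-Hahn AEP is the continuous-time Markov chain $\vec x(t)$ on $\mathbb X^\infty$ in which, for each $n\ge 1$, $x_n$ jumps to $x_n+j$ at rate $\phi^R(j\,|\,x_{n-1}-x_n-1)$ for $1\le j\le x_{n-1}-x_n-1$,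 and to $x_n-j$ at rate $\phi^L(j\,|\,x_n-x_{n+1}-1)$ for $1\le j\le x_n-x_{n+1}-1$. Let $W^k=\{\vec n\in\mathbb Z_{\ge 0}^k : n_1\ge\dots\ge n_k\}$, $\|\vec n\|=n_1+\dots+n_k$, and for $\vec n\in W^k$ let $y_i=y_i(\vec n)=\#\{a : n_a=i\}$, $i\ge 0$; this identifies $W^k$ with the sequences $(y_0,y_1,\dots)$ of nonnegative integers with sum $k$. The $k$-particle $q$-Hahn AZRP is the continuous-time Markov chain $\vec n(t)$ on $W^k$ in which, for each $i\ge 1$ and $1\le j\le y_i$, $j$ of the particles at $i$ move together to $i-1$ at rate $\phi^R(j|y_i)$ and to $i+1$ at rate $\phi^L(j|y_i)$ (no particle leaves site $0$). Let $B$ denote its generator, acting on functions $W^k\to\mathbb R$. Define $H(\vec x,\vec n)=\prod_{i\ge 0}q^{(x_i+i)\,y_i(\vec n)}=\prod_{a=1}^k q^{x_{n_a}+n_a}$, which is $0$ if some $n_a=0$. Say that $h:\mathbb R_+\times W^k\to\mathbb R$ solves the $k$-particle true evolution equation with initial data $h_0$ if 1. $\frac{d}{dt}h(t,\vec n)=B\,h(t,\vec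 n)$ for all $\vec n\in W^k$, $t\in\mathbb R_+$ (a one-sided derivative at $t=0$); 2. $h(t,\vec n)\to h_0(\vec n)$ as $t\to 0^+$, for all $\vec n\in W^k$; 3. for every $T>0$ there are constants $c,C>0$ such that for all $t\in[0,T]$: $|h(t,\vec n)|\le Ce^{c\|\vec n\|}$ for all $\vec n\in W^k$, and $|h(t,\vec n)-h(t,\vec n')|\le C\,\big|e^{c\|\vec n\|}-e^{c\|\vec n'\|}\big|$ for all $\vec n,\vec n'\in W^k$ with $\|\vec n\|\ne\|\vec n'\|$. **Corollary.** (a) For every $\vec x\in\mathbb X^\infty$, the function $u(t,\vec n)=\mathbb E^{\vec x}[H(\vec x(t),\vec n)]$ solves the $k$-particle true evolution equation with initial data $h_0(\vec n)=H(\vec x,\vec n)$. (b) The $q$-Hahn AEP and the $k$-particle $q$-Hahn AZRP are dual with respect to $H$: for all $\vec x\in\mathbb X^\infty$, $\vec n\in W^k$ and $t\ge 0$, the random variables $H(\vec x(t),\vec n)$ (under $\mathbb P^{\vec x}$) and $H(\vec x,\vec n(t))$ (under $\mathbb P^{\vec n}$) are integrable and $$\mathbb E^{\vec x}[H(\vec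 x(t),\vec n)]=\mathbb E^{\vec n}[H(\vec x,\vec n(t))].$$ -/

import Mathlib

open MeasureTheory ProbabilityTheory Filter Topology Set
open scoped ENNReal

noncomputable section

namespace QHahn

/-! ### Continuous-time Markov chains on a discrete state space, from their generator -/

section MarkovChain

variable {S : Type*}

open Classical in
/-- The jump rate from `x` to `y ≠ x` encoded by a generator `G`, namely `(G 1_{y}) (x)`. -/
def jumpRate (G : (S → ℝ) → S → ℝ) (x y : S) : ℝ≥0∞ :=
  if x = y then 0 else ENNReal.ofReal (G (fun z => if z = y then 1 else 0) x)

/-- The total rate at which the chain leaves the state `x`. -/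
def exitRate (G : (S → ℝ) → S → ℝ) (x : S) : ℝ≥0∞ := ∑' y, jumpRate G x y

open Classical in
/-- The law of the state reached when the chain leaves `x`: the state `y` has probability
`jumpRate G x y / exitRate G x`. (A Dirac mass at `x` if `x` is absorbing.) -/
def jumpPMF (G : (S → ℝ) → S → ℝ) (x : S) : PMF S :=
  if h : (∑' y, jumpRate G x y) ≠ 0 ∧ (∑' y, jumpRate G x y) ≠ ∞ then
    PMF.normalize (jumpRate G x) h.1 h.2
  else PMF.pure x

/-- The time of the `n`-th jump. The holding time in `Y_i` is exponential
of rate `exitRate G Y_i` (infinite if `Y_i` is absorbing). -/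
def jumpTime (G : (S → ℝ) → S → ℝ) (ω : (ℕ → S) × (ℕ → ℝ)) (n : ℕ) : ℝ≥0∞ :=
  ∑ i ∈ Finset.range n, ENNReal.ofReal (ω.2 i) / exitRate G (ω.1 i)

open Classical in
/-- The state at time `t ≥ 0`: it is `Y_n` if `t` lies between the `n`-th and `(n+1)`-st jump times,
and `none` if infinitely many jumps occurred before time `t` (explosion). -/
def stateAt (G : (S → ℝ) → S → ℝ) (t : ℝ) (ω : (ℕ → S) × (ℕ → ℝ)) : Option S :=
  if h : ∃ n, jumpTime G ω n ≤ ENNReal.ofReal t ∧ ENNReal.ofReal t < jumpTime G ω (n + 1) then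
    some (ω.1 (Nat.find h))
  else none

/-- The random variable `f (X_t)`, with value `0` after an explosion. -/
def observe (G : (S → ℝ) → S → ℝ) (t : ℝ) (f : S → ℝ) (ω : (ℕ → S) × (ℕ → ℝ)) : ℝ :=
  (stateAt G t ω).elim 0 f

variable [MeasurableSpace S] [DiscreteMeasurableSpace S]

/-- The transition kernel of the embedded jump chain. -/
def jumpKernel (G : (S → ℝ) → S → ℝ) : Kernel S S :=
  ⟨fun x => (jumpPMF G x).toMeasure, Measurable.of_discrete⟩

instance (G : (S → ℝ) → S → ℝ) : IsMarkovKernel (jumpKernel G) :=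
  ⟨fun x => PMF.toMeasure.isProbabilityMeasure (jumpPMF G x)⟩

/-- The same kernel, as a function of the first `n + 1` states of the embedded chain
(only the last of which matters). -/
def jumpStep (G : (S → ℝ) → S → ℝ) (n : ℕ) : Kernel (Π _ : Finset.Iic n, S) S :=
  (jumpKernel G).comap (fun h => h ⟨n, Finset.mem_Iic.2 le_rfl⟩) (measurable_pi_apply _)

instance (G : (S → ℝ) → S → ℝ) (n : ℕ) : IsMarkovKernel (jumpStep G n) := by
  unfold jumpStep; infer_instance

/-- The probability measure `P^x` of the Markov chain with generator `G` started from `x`: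
under it the first component `Y_0, Y_1, …` is the embedded jump chain started from `Y_0 = x`,
and the second component is an independent sequence of independent exponential variables
of rate `1`. -/
def chainLaw (G : (S → ℝ) → S → ℝ) (x : S) : Measure ((ℕ → S) × (ℕ → ℝ)) :=
  (Kernel.traj (X := fun _ => S) (jumpStep G) 0 (fun _ => x)).prod
    (Measure.infinitePi (fun _ : ℕ => expMeasure 1))

/-- The expectation `E^x[f (X_t)]`. -/
def expect (G : (S → ℝ) → S → ℝ) (x : S) (t : ℝ) (f : S → ℝ) : ℝ :=
  ∫ ω, observe G t f ω ∂(chainLaw G x)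

end MarkovChain

/-! ### The jump rates -/

/-- The `q`-Pochhammer symbol `(a; q)_n`. -/
def qPoch (a q : ℝ) (n : ℕ) : ℝ := ∏ i ∈ Finset.range n, (1 - a * q ^ i)

/-- The `q`-integer `[n]_q`. -/
def qInt (q : ℝ) (n : ℕ) : ℝ := ∑ i ∈ Finset.range n, q ^ i

/-- The rate `φ^R(j | m)`, for `1 ≤ j ≤ m`. -/
def phiR (q ν R : ℝ) (j m : ℕ) : ℝ :=
  R * (ν ^ (j - 1) / qInt q j) * (qPoch ν q (m - j) / qPoch ν q m) *
    (qPoch q q m / qPoch q q (m - j))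

/-- The rate `φ^R(j | ∞)`, for `1 ≤ j`: the limit of `φ^R(j | m)` as `m → ∞`. -/
def phiRInf (q ν R : ℝ) (j : ℕ) : ℝ := R * (ν ^ (j - 1) / qInt q j)

/-- The rate `φ^L(j | m)`, for `1 ≤ j ≤ m`. -/
def phiL (q ν L : ℝ) (j m : ℕ) : ℝ :=
  L * (1 / qInt q j) * (qPoch ν q (m - j) / qPoch ν q m) *
    (qPoch q q m / qPoch q q (m - j))

/-! ### The exclusion process -/

/-- The state space `𝕏^∞` of the exclusion process: `loc n` is the location of the particle with
label `n + 1`, so that `loc 0 > loc 1 > …` are `x_1 > x_2 > …`. The convention `x_0 = +∞` is built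
into the generator and the duality functional. -/
@[ext]
structure ExclConfig where
  loc : ℕ → ℤ
  strictAnti : ∀ n, loc (n + 1) < loc n
  packed : ∃ N, ∀ n, N ≤ n → loc n - loc (n + 1) = 1

instance : MeasurableSpace ExclConfig := ⊤

instance : DiscreteMeasurableSpace ExclConfig := ⟨fun _ => trivial⟩

namespace ExclConfig

/-- The number of empty sites between `loc (n + 1)` and `loc n`. -/
def gap (x : ExclConfig) (n : ℕ) : ℕ := (x.loc n - x.loc (n + 1) - 1).toNat

open Classical in
/-- The configuration obtained from `x` by displacing the particle at `loc n` by `d`. The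
generator only uses displacements that fit into the adjacent gap, for which the result is a
configuration (`moveOf_loc_right_zero`, `moveOf_loc_right`, `moveOf_loc_left`); the value `x` in
the other cases is irrelevant. -/
def moveOf (x : ExclConfig) (n : ℕ) (d : ℤ) : ExclConfig :=
  if h : (∀ m, Function.update x.loc n (x.loc n + d) (m + 1) <
        Function.update x.loc n (x.loc n + d) m) ∧
      ∃ N, ∀ m, N ≤ m → Function.update x.loc n (x.loc n + d) m -
        Function.update x.loc n (x.loc n + d) (m + 1) = 1 then
    ⟨Function.update x.loc n (x.loc n + d), h.1, h.2⟩
  else x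

theorem moveOf_loc_of_lt (x : ExclConfig) (n : ℕ) (d : ℤ)
    (h1 : ∀ m, n = m + 1 → x.loc n + d < x.loc m) (h2 : x.loc (n + 1) < x.loc n + d) :
    (x.moveOf n d).loc = Function.update x.loc n (x.loc n + d) := by
  have key : (∀ m, Function.update x.loc n (x.loc n + d) (m + 1) <
        Function.update x.loc n (x.loc n + d) m) ∧
      ∃ N, ∀ m, N ≤ m → Function.update x.loc n (x.loc n + d) m -
        Function.update x.loc n (x.loc n + d) (m + 1) = 1 := by
    constructor
    · intro m
      have := x.strictAnti m
      simp only [Function.update_apply]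
      split_ifs with h3 h4 h4
      · omega
      · exact h1 m h3.symm
      · subst h4; exact h2
      · exact this
    · obtain ⟨N, hN⟩ := x.packed
      refine ⟨max N (n + 1), fun m hm => ?_⟩
      have h3 : m ≠ n := by omega
      have h4 : m + 1 ≠ n := by omega
      simp only [Function.update_apply, h3, h4, if_false]
      exact hN m (by omega)
  unfold moveOf
  rw [dif_pos key]

theorem moveOf_loc_right_zero (x : ExclConfig) (j : ℕ) :
    (x.moveOf 0 j).loc = Function.update x.loc 0 (x.loc 0 + j) := by
  have := x.strictAnti 0
  exact x.moveOf_loc_of_lt 0 j (fun m h => by omega) (by omega)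

theorem moveOf_loc_right (x : ExclConfig) (n j : ℕ) (hj : j ≤ x.gap n) :
    (x.moveOf (n + 1) j).loc = Function.update x.loc (n + 1) (x.loc (n + 1) + j) := by
  have h1 := x.strictAnti n
  have h2 := x.strictAnti (n + 1)
  unfold gap at hj
  refine x.moveOf_loc_of_lt (n + 1) j (fun m h => ?_) (by omega)
  obtain rfl : m = n := by omega
  omega

theorem moveOf_loc_left (x : ExclConfig) (n j : ℕ) (hj : j ≤ x.gap n) :
    (x.moveOf n (-j)).loc = Function.update x.loc n (x.loc n + -j) := by
  have h1 := x.strictAnti n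
  unfold gap at hj
  refine x.moveOf_loc_of_lt n (-j) (fun m h => ?_) (by omega)
  have h2 := x.strictAnti m
  subst h
  omega

end ExclConfig

/-- The part of the generator of the `q`-Hahn AEP coming from the jumps to the right of the
particle `loc n`. The first particle has an infinite gap to its right. -/
def genRight (q ν R : ℝ) (f : ExclConfig → ℝ) (x : ExclConfig) : ℕ → ℝ
  | 0 => ∑' j : ℕ, phiRInf q ν R (j + 1) * (f (x.moveOf 0 ((j + 1 : ℕ) : ℤ)) - f x)
  | n + 1 => ∑ j ∈ Finset.Icc 1 (x.gap n),
      phiR q ν R j (x.gap n) * (f (x.moveOf (n + 1) (j : ℤ)) - f x)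

/-- The part of the generator of the `q`-Hahn AEP coming from the jumps to the left of the
particle `loc n`. -/
def genLeft (q ν L : ℝ) (f : ExclConfig → ℝ) (x : ExclConfig) (n : ℕ) : ℝ :=
  ∑ j ∈ Finset.Icc 1 (x.gap n), phiL q ν L j (x.gap n) * (f (x.moveOf n (-(j : ℤ))) - f x)

/-- The generator `T_{q,ν}` of the `q`-Hahn AEP. (The sum over `n` has finitely many nonzero
terms, since almost all gaps are zero.) -/
def genAEP (q ν R L : ℝ) (f : ExclConfig → ℝ) (x : ExclConfig) : ℝ :=
  ∑' n : ℕ, (genRight q ν R f x n + genLeft q ν L f x n)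

/-! ### The zero-range process -/

/-- The generator `B_{q,ν}` of the `q`-Hahn AZRP on the space `𝕐^∞` of finitely supported
occupation numbers `y_0, y_1, …`. There are no jumps out of the site `0`. -/
def genAZRP (q ν R L : ℝ) (f : (ℕ →₀ ℕ) → ℝ) (y : ℕ →₀ ℕ) : ℝ :=
  ∑ i ∈ y.support.erase 0,
    (∑ j ∈ Finset.Icc 1 (y i),
        phiR q ν R j (y i) * (f (y - Finsupp.single i j + Finsupp.single (i - 1) j) - f y) +
      ∑ j ∈ Finset.Icc 1 (y i),
        phiL q ν L j (y i) * (f (y - Finsupp.single i j + Finsupp.single (i + 1) j) - f y))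

/-- The Weyl chamber `W^k` of ordered particle locations `n_1 ≥ n_2 ≥ … ≥ n_k ≥ 0`. -/
@[ext]
structure Weyl (k : ℕ) where
  pos : Fin k → ℕ
  anti : Antitone pos

instance (k : ℕ) : MeasurableSpace (Weyl k) := ⊤

instance (k : ℕ) : DiscreteMeasurableSpace (Weyl k) := ⟨fun _ => trivial⟩

namespace Weyl

variable {k : ℕ}

/-- The occupation numbers: `occ n i` is the number of coordinates of `n` equal to `i`. -/
def occ (n : Weyl k) : ℕ →₀ ℕ := ∑ a, Finsupp.single (n.pos a) 1

/-- The norm `‖n‖ = n_1 + ⋯ + n_k`. -/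
def size (n : Weyl k) : ℕ := ∑ a, n.pos a

theorem occ_injective : Function.Injective (occ : Weyl k → ℕ →₀ ℕ) := by
  intro n m h
  have hM : (Finset.univ : Finset (Fin k)).val.map n.pos = Finset.univ.val.map m.pos := by
    ext i
    have := DFunLike.congr_fun h i
    simp only [occ, Finsupp.coe_finsetSum, Finset.sum_apply, Finsupp.single_apply,
      Finset.sum_boole, Nat.cast_id] at this
    simp only [Multiset.count_map, eq_comm (a := i)]
    exact this
  have hP : (List.ofFn n.pos).Perm (List.ofFn m.pos) := by
    rw [← Multiset.coe_eq_coe]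
    simpa [List.ofFn_eq_map] using hM
  have h1 : (List.ofFn n.pos).SortedGE := n.anti.sortedGE_ofFn
  have h2 : (List.ofFn m.pos).SortedGE := m.anti.sortedGE_ofFn
  have := hP.eq_of_sortedGE h1 h2
  exact Weyl.ext (List.ofFn_injective this)

end Weyl

/-- The generator `B_{q,ν}` of the `k`-particle `q`-Hahn AZRP in terms of ordered particle
locations: the generator on occupation numbers, transported along the bijection `Weyl.occ` from
`W^k` to the occupation numbers of total mass `k`. (The dynamics conserves the total mass, so that
the value `0` given to the function outside the range of `Weyl.occ` is irrelevant.) -/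
def genWeyl (q ν R L : ℝ) {k : ℕ} (h : Weyl k → ℝ) (n : Weyl k) : ℝ :=
  genAZRP q ν R L (Function.extend Weyl.occ h 0) n.occ

/-! ### Duality functional and true evolution equation -/

/-- The number `q ^ (x_i + i)`, with `q ^ (x_0 + 0) = q ^ (+∞) = 0`. -/
def weight (q : ℝ) (x : ExclConfig) : ℕ → ℝ
  | 0 => 0
  | i + 1 => q ^ (x.loc i + (i + 1 : ℤ))

/-- The functional `H(x, y) = ∏ᵢ q ^ ((x_i + i) y_i)`, which is `0` if `y_0 > 0`. -/
def dualH (q : ℝ) (x : ExclConfig) (y : ℕ →₀ ℕ) : ℝ := y.prod fun i m => weight q x i ^ m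

/-- `h : ℝ₊ × W^k → ℝ` solves the `k`-particle true evolution equation with initial data `h₀`.
The increment bound is required for locations of different norms (for locations of equal norms its
right-hand side is zero). -/
structure SolvesTrueEvolution (q ν R L : ℝ) {k : ℕ} (h : ℝ → Weyl k → ℝ) (h₀ : Weyl k → ℝ) :
    Prop where
  deriv : ∀ (n : Weyl k) (t : ℝ), 0 ≤ t →
    HasDerivWithinAt (fun s => h s n) (genWeyl q ν R L (h t) n) (Ici 0) t
  initial : ∀ n : Weyl k, Tendsto (fun t => h t n) (𝓝[>] 0) (𝓝 (h₀ n))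
  growth : ∀ T : ℝ, 0 < T → ∃ c C : ℝ, 0 < c ∧ 0 < C ∧
    (∀ (n : Weyl k) (t : ℝ), t ∈ Icc 0 T → |h t n| ≤ C * Real.exp (c * n.size)) ∧
    (∀ (n n' : Weyl k) (t : ℝ), t ∈ Icc 0 T → n.size ≠ n'.size →
      |h t n - h t n'| ≤ C * |Real.exp (c * n.size) - Real.exp (c * n'.size)|)

end QHahn

end

/-!
Write `H` for the duality functional, `T` for the generator of the exclusion process and `B` for
that of the zero-range process. The proof compares both expectations with the one function
`W t x n = (exp (t B) H(x, ·)) n`, where `B` acts on the bounded functions on `W^k`.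

The exponential makes sense because the zero-range process has only `k` particles: its exit rates
are bounded, so that `B` is a bounded operator (`exists_clm_genWeyl`), and `H(x, ·)` is a bounded
function, uniformly in `x` on each set of configurations with a given tail constant
`c = lim (loc n + n)`, a quantity that the exclusion process conserves (`abs_dualH_le`).

* In the variable `n`, the function `W` solves `∂W = B W`, by construction.
* In the variable `x`, it solves `∂W = T W`: the derivative is `exp (t B) (B H(x, ·))`, duality of
  the generators (`genAEP_dualH`) replaces `B H(x, ·)` by `T` acting on `x`, a convergent series of
  bounded functions, and the bounded operator `exp (t B)` passes through that series.

So `W` is a bounded solution of the backward equations of both chains. For a nonexplosive chain such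
a solution is the expectation of its initial data along the chain (`SolvesBackward.expect_eq`). This
is proved by iterating the Markov property at the jump times (`map_jumpPoint_step`,
`SolvesBackward.integral_step`); the remainder after `n` jumps is controlled by the probability that
the `n`-th jump comes before `t`. That probability tends to `0` by a Lyapunov function argument
(`tendsto_measure_jumpTime_le`), applied to `1 +` the number of holes behind the first particle for
the exclusion process, which only the right jumps of the first particle increase, and to a constant for
the zero-range process. Hence both expectations equal `W`. The evolution equation and the growth
bounds are then properties of `exp (t B)`: as `W` is bounded on `[0, T]` and distinct values of
`exp ‖n‖` are at least `1` apart, `c = 1` works in both bounds.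

The duality of the generators reduces, site by site, to the symmetry in `m` and `y` of the sums
`∑ j, φ^R(j|m) (q ^ (j y) - 1)` and `∑ j, φ^L(j|m) (q ^ (-j y) - 1)` (`sum_phiR_comm`,
`sum_phiL_comm`), and for the first particle to the limit `m → ∞` of the former
(`hasSum_phiRInf`). The mixed differences of these sums are affine functions,
with coefficients symmetric in the two variables, of auxiliary arrays, whose symmetry follows by
induction from a first-order recursion with compatible coefficients (`symm_of_recursion`).
-/

noncomputable section

namespace QHahn

/-! ### Symmetry identities for the jump rates -/

section Rates

variable {q ν : ℝ}

theorem qPoch_succ (a q : ℝ) (n : ℕ) : qPoch a q (n + 1) = qPoch a q n * (1 - a * q ^ n) := by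
  simp [qPoch, Finset.prod_range_succ]

theorem qPoch_pos {a q : ℝ} (hq0 : 0 < q) (hq1 : q < 1) (ha1 : a < 1) (n : ℕ) :
    0 < qPoch a q n := by
  refine Finset.prod_pos fun i _ => ?_
  have h1 : q ^ i ≤ 1 := pow_le_one₀ hq0.le hq1.le
  nlinarith [pow_pos hq0 i]

theorem qInt_pos (hq0 : 0 < q) {j : ℕ} (hj : 1 ≤ j) : 0 < qInt q j := by
  refine Finset.sum_pos (fun i _ => pow_pos hq0 i) ?_
  exact Finset.nonempty_range_iff.2 (by omega)

theorem one_sub_mul_qInt (q : ℝ) (j : ℕ) : (1 - q) * qInt q j = 1 - q ^ j :=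
  mul_neg_geom_sum q j

/-- The coefficients `(ν; q)_n / (q; q)_n` of the `q`-binomial series. -/
def qBinCoeff (q ν : ℝ) (n : ℕ) : ℝ := qPoch ν q n / qPoch q q n

/-- The sum `∑_{1 ≤ j ≤ m} z ^ (j - 1) a_{m - j} / a_m` with `a = qBinCoeff q ν`. -/
def qBinSum (q ν z : ℝ) (m : ℕ) : ℝ :=
  ∑ j ∈ Finset.range m, z ^ j * (qBinCoeff q ν (m - (j + 1)) / qBinCoeff q ν m)

theorem one_sub_mul_pow_pos (hq0 : 0 < q) (hq1 : q < 1) (hν1 : ν < 1) (m : ℕ) :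
    0 < 1 - ν * q ^ m := by
  have h1 : q ^ m ≤ 1 := pow_le_one₀ hq0.le hq1.le
  nlinarith [pow_pos hq0 m]

theorem qBinCoeff_pos (hq0 : 0 < q) (hq1 : q < 1) (hν1 : ν < 1) (m : ℕ) :
    0 < qBinCoeff q ν m :=
  div_pos (qPoch_pos hq0 hq1 hν1 m) (qPoch_pos hq0 hq1 hq1 m)

/-- The first-order recursion that all the symmetry identities rest on. -/
theorem qBinSum_succ (hq0 : 0 < q) (hq1 : q < 1) (hν1 : ν < 1) (z : ℝ) (m : ℕ) :
    (1 - ν * q ^ m) * qBinSum q ν z (m + 1) = (1 - q ^ (m + 1)) * (1 + z * qBinSum q ν z m) := by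
  have ha := qBinCoeff_pos hq0 hq1 hν1 m
  have ha' := qBinCoeff_pos hq0 hq1 hν1 (m + 1)
  have hstep : (1 - q ^ (m + 1)) * qBinCoeff q ν (m + 1) = (1 - ν * q ^ m) * qBinCoeff q ν m := by
    have h1 := qPoch_pos hq0 hq1 hq1 m
    have h2 : 0 < 1 - q ^ (m + 1) := by
      have := one_sub_mul_pow_pos hq0 hq1 hq1 m
      rwa [← pow_succ'] at this
    have h2' : 1 - q * q ^ m ≠ 0 := by rw [← pow_succ']; exact h2.ne'
    unfold qBinCoeff
    rw [qPoch_succ, qPoch_succ, pow_succ']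
    field_simp
  have hS : qBinCoeff q ν (m + 1) * qBinSum q ν z (m + 1)
      = qBinCoeff q ν m * (1 + z * qBinSum q ν z m) := by
    unfold qBinSum
    rw [Finset.sum_range_succ', mul_add, mul_add, Finset.mul_sum, Finset.mul_sum, Finset.mul_sum,
      add_comm]
    congr 1
    · simp
      field_simp
    · refine Finset.sum_congr rfl fun j _ => ?_
      rw [show m + 1 - (j + 1 + 1) = m - (j + 1) by omega]
      field_simp
      ring
  have : qBinCoeff q ν (m + 1) * ((1 - ν * q ^ m) * qBinSum q ν z (m + 1)) =
      qBinCoeff q ν (m + 1) * ((1 - q ^ (m + 1)) * (1 + z * qBinSum q ν z m)) := by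
    calc _ = (1 - ν * q ^ m) * (qBinCoeff q ν (m + 1) * qBinSum q ν z (m + 1)) := by ring
      _ = ((1 - ν * q ^ m) * qBinCoeff q ν m) * (1 + z * qBinSum q ν z m) := by rw [hS]; ring
      _ = _ := by rw [← hstep]; ring
  exact mul_left_cancel₀ ha'.ne' this

@[simp] theorem qBinSum_zero (q ν z : ℝ) : qBinSum q ν z 0 = 0 := by simp [qBinSum]

/-- A two-variable array that vanishes on the axes is symmetric if its mixed differences are. -/
theorem apply_comm_of_mixed_diff_comm {F : ℕ → ℕ → ℝ} (h0 : ∀ m, F m 0 = 0) (h0' : ∀ y, F 0 y = 0)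
    (hK : ∀ m l, (F (m + 1) (l + 1) - F (m + 1) l) - (F m (l + 1) - F m l) =
      (F (l + 1) (m + 1) - F (l + 1) m) - (F l (m + 1) - F l m)) (m y : ℕ) : F m y = F y m := by
  have key : ∀ m y, F m y = ∑ l ∈ Finset.range y, ∑ i ∈ Finset.range m,
      ((F (i + 1) (l + 1) - F (i + 1) l) - (F i (l + 1) - F i l)) := by
    intro m y
    have h1 : ∀ l, ∑ i ∈ Finset.range m, ((F (i + 1) (l + 1) - F (i + 1) l) -
        (F i (l + 1) - F i l)) = F m (l + 1) - F m l := fun l => by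
      rw [Finset.sum_range_sub (fun i => F i (l + 1) - F i l), h0', h0', sub_zero, sub_zero]
    rw [Finset.sum_congr rfl fun l _ => h1 l, Finset.sum_range_sub (F m), h0, sub_zero]
  rw [key, key y m, Finset.sum_comm]
  exact Finset.sum_congr rfl fun i _ => Finset.sum_congr rfl fun l _ => hK _ _

/-- The array that governs the mixed differences of `rightSum`. -/
def rightAux (q ν : ℝ) (m l : ℕ) : ℝ :=
  (q ^ l * qBinSum q ν (ν * q ^ l) m + q ^ m) / (1 - ν * q ^ m)

/-- The array that governs the mixed differences of `leftSum`. -/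
def leftAux (q ν : ℝ) (m l : ℕ) : ℝ :=
  q ^ m * (1 + (q ^ (l + 1))⁻¹ * qBinSum q ν (q ^ (l + 1))⁻¹ m) / (1 - ν * q ^ m)

/-- A two-variable array solving a first-order recursion in each row solves the mirrored recursion
in each column as soon as the first row does, provided the coefficients are compatible. -/
theorem symm_of_recursion {Y : ℕ → ℕ → ℝ} {α : ℕ → ℝ} {β γ : ℕ → ℕ → ℝ} (c : ℝ)
    (hα : ∀ m, α m ≠ 0) (h0 : ∀ l, Y 0 l = c)
    (hrec : ∀ m l, α (m + 1) * Y (m + 1) l = β m l + γ m l * Y m l)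
    (hc : ∀ l, (α (l + 1) - γ l 0) * c = β l 0)
    (h1 : ∀ m l, γ m (l + 1) * γ l m = γ l (m + 1) * γ m l)
    (h2 : ∀ m l, α (l + 1) * β m (l + 1) + γ m (l + 1) * β l m =
      α (m + 1) * β l (m + 1) + γ l (m + 1) * β m l) (m l : ℕ) : Y m l = Y l m := by
  have hcol : ∀ m l, α (l + 1) * Y m (l + 1) = β l m + γ l m * Y m l := by
    intro m
    induction m with
    | zero => intro l; rw [h0, h0]; linear_combination hc l
    | succ m ih =>
      intro l
      refine mul_left_cancel₀ (hα (m + 1)) ?_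
      linear_combination α (l + 1) * hrec m (l + 1) + γ m (l + 1) * ih l
        - γ l (m + 1) * hrec m l + h2 m l + Y m l * h1 m l
  induction m generalizing l with
  | zero =>
    rw [h0]
    induction l with
    | zero => rw [h0]
    | succ l ih =>
      refine mul_left_cancel₀ (hα (l + 1)) ?_
      rw [hrec, ← ih]
      linear_combination hc l
  | succ m ih =>
    refine mul_left_cancel₀ (hα (m + 1)) ?_
    rw [hrec, hcol, ih]

theorem rightAux_comm (hq0 : 0 < q) (hq1 : q < 1) (hν1 : ν < 1) (m l : ℕ) :
    rightAux q ν m l = rightAux q ν l m := by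
  have hD := one_sub_mul_pow_pos hq0 hq1 hν1
  refine symm_of_recursion (α := fun m => 1 - ν * q ^ m)
    (β := fun m l => q ^ l + q ^ (m + 1) - q ^ (l + m + 1))
    (γ := fun m l => ν * q ^ l * (1 - q ^ (m + 1))) (1 / (1 - ν)) (fun m => (hD m).ne') ?_ ?_ ?_
    ?_ ?_ m l
  · intro l; simp [rightAux]
  · intro m l
    have h := qBinSum_succ hq0 hq1 hν1 (ν * q ^ l) m
    have h1 := (hD m).ne'
    have h2 := (hD (m + 1)).ne'
    unfold rightAux
    generalize qBinSum q ν (ν * q ^ l) (m + 1) = A at *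
    generalize qBinSum q ν (ν * q ^ l) m = B at *
    rw [mul_div_cancel₀ _ h2]
    field_simp
    linear_combination q ^ l * h
  · intro l
    have : 1 - ν ≠ 0 := by linarith
    field_simp
    ring
  · intro m l; ring
  · intro m l; ring

theorem leftAux_comm (hq0 : 0 < q) (hq1 : q < 1) (hν1 : ν < 1) (m l : ℕ) :
    leftAux q ν m l = leftAux q ν l m := by
  have hD := one_sub_mul_pow_pos hq0 hq1 hν1
  have hqn : ∀ n : ℕ, q ^ n ≠ 0 := fun n => (pow_pos hq0 n).ne'
  have hE : ∀ m, (q ^ m)⁻¹ - ν = (1 - ν * q ^ m) * (q ^ m)⁻¹ := fun m => by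
    have := hqn m
    field_simp
  refine symm_of_recursion (α := fun m => (q ^ m)⁻¹ - ν) (β := fun m l => 1)
    (γ := fun m l => (q ^ l)⁻¹ * ((q ^ (m + 1))⁻¹ - 1)) (1 / (1 - ν)) (fun m => ?_) ?_ ?_
    ?_ ?_ ?_ m l
  · rw [hE]; exact mul_ne_zero (hD m).ne' (inv_ne_zero (hqn m))
  · intro l; simp [leftAux]
  · intro m l
    have h := qBinSum_succ hq0 hq1 hν1 (q ^ (l + 1))⁻¹ m
    have h1 := (hD m).ne'
    have h2 := (hD (m + 1)).ne'
    have h3 := hqn l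
    have h4 := hqn m
    unfold leftAux
    simp only [hE]
    generalize qBinSum q ν (q ^ (l + 1))⁻¹ (m + 1) = A at *
    generalize qBinSum q ν (q ^ (l + 1))⁻¹ m = B at *
    rw [show (1 - ν * q ^ (m + 1)) * (q ^ (m + 1))⁻¹ *
      (q ^ (m + 1) * (1 + (q ^ (l + 1))⁻¹ * A) / (1 - ν * q ^ (m + 1))) = 1 + (q ^ (l + 1))⁻¹ * A by
        field_simp]
    have hA : A = (1 - q ^ (m + 1)) * (1 + (q ^ (l + 1))⁻¹ * B) / (1 - ν * q ^ m) := by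
      rw [eq_div_iff h1]; linarith
    rw [hA]
    rw [pow_succ q l, pow_succ q m]
    field_simp
  · intro l
    have : 1 - ν ≠ 0 := by linarith
    have := hqn (l + 1)
    field_simp
    ring
  · intro m l; ring
  · intro m l
    have h3 := hqn l
    have h4 := hqn m
    simp only [pow_succ]
    field_simp
    ring

/-- The expected decrease `∑_j φ^R(j|m) (1 - q ^ (j y))` (for `R = 1`). -/
def rightSum (q ν : ℝ) (m y : ℕ) : ℝ :=
  ∑ j ∈ Finset.range m, ν ^ j / qInt q (j + 1) *
    (qBinCoeff q ν (m - (j + 1)) / qBinCoeff q ν m) * (1 - q ^ ((j + 1) * y))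

/-- The expected increase `∑_j φ^L(j|m) (q ^ (-j y) - 1)` (for `L = 1`). -/
def leftSum (q ν : ℝ) (m y : ℕ) : ℝ :=
  ∑ j ∈ Finset.range m, 1 / qInt q (j + 1) *
    (qBinCoeff q ν (m - (j + 1)) / qBinCoeff q ν m) * ((q ^ ((j + 1) * y))⁻¹ - 1)

theorem rightSum_succ_sub (hq0 : 0 < q) (m l : ℕ) : rightSum q ν m (l + 1) - rightSum q ν m l =
    (1 - q) * (q ^ l * qBinSum q ν (ν * q ^ l) m) := by
  unfold rightSum qBinSum
  rw [← Finset.sum_sub_distrib, Finset.mul_sum, Finset.mul_sum]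
  refine Finset.sum_congr rfl fun j _ => ?_
  have h := one_sub_mul_qInt q (j + 1)
  have h1 := (qInt_pos hq0 (Nat.le_add_left 1 j)).ne'
  have h2 : (1 - q ^ ((j + 1) * (l + 1))) - (1 - q ^ ((j + 1) * l)) =
      q ^ ((j + 1) * l) * ((1 - q) * qInt q (j + 1)) := by rw [h]; ring
  rw [← mul_sub, h2]
  field_simp
  ring

theorem leftSum_succ_sub (hq0 : 0 < q) (m l : ℕ) : leftSum q ν m (l + 1) - leftSum q ν m l =
    (1 - q) * ((q ^ (l + 1))⁻¹ * qBinSum q ν (q ^ (l + 1))⁻¹ m) := by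
  unfold leftSum qBinSum
  rw [← Finset.sum_sub_distrib, Finset.mul_sum, Finset.mul_sum]
  refine Finset.sum_congr rfl fun j _ => ?_
  have h := one_sub_mul_qInt q (j + 1)
  have h1 := (qInt_pos hq0 (Nat.le_add_left 1 j)).ne'
  have h2 : ((q ^ ((j + 1) * (l + 1)))⁻¹ - 1) - ((q ^ ((j + 1) * l))⁻¹ - 1) =
      (q ^ ((j + 1) * (l + 1)))⁻¹ * ((1 - q) * qInt q (j + 1)) := by
    rw [h, show (j + 1) * (l + 1) = (j + 1) * l + (j + 1) by ring, pow_add]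
    have := (pow_pos hq0 ((j + 1) * l)).ne'
    have := (pow_pos hq0 (j + 1)).ne'
    field_simp
    ring
  rw [← mul_sub, h2]
  have : (q ^ ((j + 1) * (l + 1)))⁻¹ = (q ^ (l + 1))⁻¹ * (q ^ (l + 1))⁻¹ ^ j := by
    rw [← pow_succ', inv_pow, ← pow_mul]; congr 2; ring
  rw [this]
  field_simp

theorem rightSum_comm (hq0 : 0 < q) (hq1 : q < 1) (hν1 : ν < 1) (m y : ℕ) :
    rightSum q ν m y = rightSum q ν y m := by
  have hD := one_sub_mul_pow_pos hq0 hq1 hν1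
  have key : ∀ m l, q ^ l * qBinSum q ν (ν * q ^ l) (m + 1) - q ^ l * qBinSum q ν (ν * q ^ l) m =
      (q ^ l + q ^ m - q ^ (m + l + 1)) -
        (1 - ν * q ^ m - ν * q ^ l + ν * q ^ (m + l + 1)) * rightAux q ν m l := by
    intro m l
    have h1 := (hD m).ne'
    have h := qBinSum_succ hq0 hq1 hν1 (ν * q ^ l) m
    have hA : qBinSum q ν (ν * q ^ l) (m + 1) =
        (1 - q ^ (m + 1)) * (1 + (ν * q ^ l) * qBinSum q ν (ν * q ^ l) m) / (1 - ν * q ^ m) := by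
      rw [eq_div_iff h1]; linarith
    unfold rightAux
    rw [hA]
    field_simp
    ring
  refine apply_comm_of_mixed_diff_comm (F := rightSum q ν) ?_ ?_ ?_ m y
  · intro m; simp [rightSum]
  · intro y; simp [rightSum]
  · intro m l
    simp only [rightSum_succ_sub hq0]
    have h := rightAux_comm hq0 hq1 hν1 m l
    rw [← mul_sub (1 - q), ← mul_sub (1 - q), key, key, h, add_comm m l]
    ring

theorem leftSum_comm (hq0 : 0 < q) (hq1 : q < 1) (hν1 : ν < 1) (m y : ℕ) :
    leftSum q ν m y = leftSum q ν y m := by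
  have hD := one_sub_mul_pow_pos hq0 hq1 hν1
  have key : ∀ m l, (q ^ (l + 1))⁻¹ * qBinSum q ν (q ^ (l + 1))⁻¹ (m + 1) -
      (q ^ (l + 1))⁻¹ * qBinSum q ν (q ^ (l + 1))⁻¹ m =
      1 - ((q ^ m)⁻¹ - ν - (q ^ (m + l + 1))⁻¹ + (q ^ l)⁻¹) * leftAux q ν m l := by
    intro m l
    have h1 := (hD m).ne'
    have h := qBinSum_succ hq0 hq1 hν1 (q ^ (l + 1))⁻¹ m
    have hY : (1 - ν * q ^ m) * leftAux q ν m l =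
        q ^ m * (1 + (q ^ (l + 1))⁻¹ * qBinSum q ν (q ^ (l + 1))⁻¹ m) := by
      rw [leftAux, mul_div_cancel₀ _ h1]
    have hP : (q ^ m)⁻¹ * q ^ m = 1 := inv_mul_cancel₀ (pow_pos hq0 m).ne'
    have hl : (q ^ l)⁻¹ = (q ^ (l + 1))⁻¹ * q := by
      rw [pow_succ, mul_inv, inv_mul_cancel_right₀ hq0.ne']
    have hml : (q ^ (m + l + 1))⁻¹ = (q ^ m)⁻¹ * (q ^ (l + 1))⁻¹ := by
      rw [add_assoc, pow_add, mul_inv]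
    rw [hl, hml]
    generalize qBinSum q ν (q ^ (l + 1))⁻¹ (m + 1) = A at *
    generalize qBinSum q ν (q ^ (l + 1))⁻¹ m = B at *
    generalize (q ^ (l + 1))⁻¹ = p at *
    generalize (q ^ m)⁻¹ = P at *
    refine mul_left_cancel₀ h1 ?_
    linear_combination p * h + (P - ν - P * p + p * q) * hY + (1 + p * B) * (1 - p) * hP
  refine apply_comm_of_mixed_diff_comm (F := leftSum q ν) ?_ ?_ ?_ m y
  · intro m; simp [leftSum]
  · intro y; simp [leftSum]
  · intro m l
    simp only [leftSum_succ_sub hq0]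
    have h := leftAux_comm hq0 hq1 hν1 m l
    rw [← mul_sub (1 - q), ← mul_sub (1 - q), key, key, h, add_comm m l]
    ring

theorem phiR_eq (R : ℝ) (j m : ℕ) : phiR q ν R (j + 1) m = R * (ν ^ j / qInt q (j + 1) *
    (qBinCoeff q ν (m - (j + 1)) / qBinCoeff q ν m)) := by
  simp only [phiR, qBinCoeff, Nat.add_sub_cancel, div_eq_mul_inv, mul_inv, inv_inv]
  ring

theorem phiL_eq (L : ℝ) (j m : ℕ) : phiL q ν L (j + 1) m = L * (1 / qInt q (j + 1) *
    (qBinCoeff q ν (m - (j + 1)) / qBinCoeff q ν m)) := by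
  simp only [phiL, qBinCoeff, div_eq_mul_inv, mul_inv, inv_inv]
  ring

theorem sum_Icc_one_eq_sum_range (f : ℕ → ℝ) (m : ℕ) :
    ∑ j ∈ Finset.Icc 1 m, f j = ∑ j ∈ Finset.range m, f (j + 1) := by
  rw [Finset.range_eq_Ico, Finset.sum_Ico_add' f 0 m 1]
  rfl

theorem sum_phiR_mul (R : ℝ) (m y : ℕ) :
    ∑ j ∈ Finset.Icc 1 m, phiR q ν R j m * (q ^ (j * y) - 1) = -(R * rightSum q ν m y) := by
  rw [sum_Icc_one_eq_sum_range, rightSum, Finset.mul_sum, ← Finset.sum_neg_distrib]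
  refine Finset.sum_congr rfl fun j _ => ?_
  rw [phiR_eq]; ring

theorem sum_phiL_mul (L : ℝ) (m y : ℕ) :
    ∑ j ∈ Finset.Icc 1 m, phiL q ν L j m * ((q ^ (j * y))⁻¹ - 1) = L * leftSum q ν m y := by
  rw [sum_Icc_one_eq_sum_range, leftSum, Finset.mul_sum]
  refine Finset.sum_congr rfl fun j _ => ?_
  rw [phiL_eq]; ring

/-- Local duality for the right jumps: the gap and the occupation number can be exchanged. -/
theorem sum_phiR_comm (hq0 : 0 < q) (hq1 : q < 1) (hν1 : ν < 1) (R : ℝ) (m y : ℕ) :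
    ∑ j ∈ Finset.Icc 1 m, phiR q ν R j m * (q ^ (j * y) - 1) =
      ∑ j ∈ Finset.Icc 1 y, phiR q ν R j y * (q ^ (j * m) - 1) := by
  rw [sum_phiR_mul, sum_phiR_mul, rightSum_comm hq0 hq1 hν1]

/-- Local duality for the left jumps: the gap and the occupation number can be exchanged. -/
theorem sum_phiL_comm (hq0 : 0 < q) (hq1 : q < 1) (hν1 : ν < 1) (L : ℝ) (m y : ℕ) :
    ∑ j ∈ Finset.Icc 1 m, phiL q ν L j m * ((q ^ (j * y))⁻¹ - 1) =
      ∑ j ∈ Finset.Icc 1 y, phiL q ν L j y * ((q ^ (j * m))⁻¹ - 1) := by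
  rw [sum_phiL_mul, sum_phiL_mul, leftSum_comm hq0 hq1 hν1]

/-- The total jump rate `∑_j φ^R(j|y)` (for `R = 1`), obtained as the limit of `rightSum q ν y m`
as `m → ∞`: by `rightSum_comm` its increments are limits of a first-order recursion. -/
theorem sum_qBinCoeff_eq (hq0 : 0 < q) (hq1 : q < 1) (hν1 : ν < 1) (y : ℕ) :
    ∑ j ∈ Finset.range y, ν ^ j / qInt q (j + 1) *
      (qBinCoeff q ν (y - (j + 1)) / qBinCoeff q ν y) =
    ∑ l ∈ Finset.range y, (1 - q) * (q ^ l / (1 - ν * q ^ l)) := by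
  have hD := one_sub_mul_pow_pos hq0 hq1 hν1
  have hpow : Tendsto (fun m : ℕ => q ^ m) atTop (𝓝 0) :=
    tendsto_pow_atTop_nhds_zero_of_lt_one hq0.le hq1
  set g : ℕ → ℝ := fun y => ∑ j ∈ Finset.range y, ν ^ j / qInt q (j + 1) *
      (qBinCoeff q ν (y - (j + 1)) / qBinCoeff q ν y) with hg
  have hlim : ∀ y, Tendsto (fun m => rightSum q ν y m) atTop (𝓝 (g y)) := by
    intro y
    refine tendsto_finsetSum _ fun j _ => ?_
    have h1 : Tendsto (fun m : ℕ => q ^ ((j + 1) * m)) atTop (𝓝 0) := by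
      simp_rw [pow_mul]
      exact tendsto_pow_atTop_nhds_zero_of_lt_one (by positivity)
        (pow_lt_one₀ hq0.le hq1 (by omega))
    simpa using (h1.const_sub 1).const_mul (ν ^ j / qInt q (j + 1) *
      (qBinCoeff q ν (y - (j + 1)) / qBinCoeff q ν y))
  have hinc : ∀ l, g (l + 1) - g l = (1 - q) * (q ^ l / (1 - ν * q ^ l)) := by
    intro l
    have h1 : Tendsto (fun m => (1 - q) * (q ^ l * qBinSum q ν (ν * q ^ l) m)) atTop
        (𝓝 (g (l + 1) - g l)) := by
      refine ((hlim (l + 1)).sub (hlim l)).congr fun m => ?_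
      rw [← rightSum_succ_sub hq0, rightSum_comm hq0 hq1 hν1 (l + 1),
        rightSum_comm hq0 hq1 hν1 l]
    have h2 : (1 - q) * q ^ l ≠ 0 := mul_ne_zero (by linarith) (pow_pos hq0 l).ne'
    set s := (g (l + 1) - g l) / ((1 - q) * q ^ l) with hs
    have h3 : Tendsto (fun m => qBinSum q ν (ν * q ^ l) m) atTop (𝓝 s) := by
      refine (h1.div_const ((1 - q) * q ^ l)).congr fun m => ?_
      rw [← mul_assoc, mul_div_cancel_left₀ _ h2]
    have h4 := ((hpow.const_mul ν).const_sub 1).mul (h3.comp (tendsto_add_atTop_nat 1))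
    have h5 := ((hpow.comp (tendsto_add_atTop_nat 1)).const_sub 1).mul
      ((h3.const_mul (ν * q ^ l)).const_add 1)
    have h6 := tendsto_nhds_unique (h4.congr fun m => qBinSum_succ hq0 hq1 hν1 _ m) h5
    have h7 : s = 1 / (1 - ν * q ^ l) := by
      rw [eq_div_iff (hD l).ne']; linarith
    have h8 : g (l + 1) - g l = s * ((1 - q) * q ^ l) := by
      rw [hs, div_mul_cancel₀ _ h2]
    rw [h8, h7]
    ring
  have h0 : g 0 = 0 := by simp [hg]
  change g y = _
  rw [← Finset.sum_congr rfl fun l _ => hinc l, Finset.sum_range_sub, h0, sub_zero]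

theorem summable_phiRInf (hq0 : 0 < q) (hν0 : 0 ≤ ν) (hν1 : ν < 1) (R : ℝ) :
    Summable fun j : ℕ => phiRInf q ν R (j + 1) := by
  refine Summable.mul_left R ?_
  refine Summable.of_nonneg_of_le (fun j => ?_) (fun j => ?_)
    (summable_geometric_of_lt_one hν0 hν1)
  · exact div_nonneg (pow_nonneg hν0 _) (qInt_pos hq0 (by omega)).le
  · refine div_le_self (pow_nonneg hν0 _) ?_
    rw [qInt, Finset.sum_range_succ']
    simp only [pow_zero, le_add_iff_nonneg_left]
    exact Finset.sum_nonneg fun i _ => by positivity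

/-- Local duality for the right jumps into an infinite gap. -/
theorem hasSum_phiRInf (hq0 : 0 < q) (hq1 : q < 1) (hν0 : 0 ≤ ν) (hν1 : ν < 1) (R : ℝ) (y : ℕ) :
    HasSum (fun j : ℕ => phiRInf q ν R (j + 1) * (q ^ ((j + 1) * y) - 1))
      (-∑ j ∈ Finset.Icc 1 y, phiR q ν R j y) := by
  have h1 : ∑ j ∈ Finset.Icc 1 y, phiR q ν R j y =
      R * ∑ l ∈ Finset.range y, (1 - q) * (q ^ l / (1 - ν * q ^ l)) := by
    rw [← sum_qBinCoeff_eq hq0 hq1 hν1, sum_Icc_one_eq_sum_range, Finset.mul_sum]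
    exact Finset.sum_congr rfl fun j _ => phiR_eq R j y
  rw [h1, ← mul_neg, ← Finset.sum_neg_distrib]
  have h2 : HasSum (fun j : ℕ => ∑ l ∈ Finset.range y, -((1 - q) * (q ^ l * (ν * q ^ l) ^ j)))
      (∑ l ∈ Finset.range y, -((1 - q) * (q ^ l / (1 - ν * q ^ l)))) := by
    refine hasSum_sum fun l _ => ?_
    have h3 : ν * q ^ l < 1 := by
      have := one_sub_mul_pow_pos hq0 hq1 hν1 l; linarith
    have h4 := hasSum_geometric_of_lt_one (mul_nonneg hν0 (pow_nonneg hq0.le l)) h3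
    simpa [div_eq_mul_inv] using ((h4.mul_left (q ^ l)).mul_left (1 - q)).neg
  refine (h2.mul_left R).congr_fun fun j => ?_
  have h5 := one_sub_mul_qInt q (j + 1)
  have h6 := (qInt_pos hq0 (Nat.le_add_left 1 j)).ne'
  have h7 : q ^ ((j + 1) * y) - 1 =
      ((1 - q) * qInt q (j + 1)) * -∑ l ∈ Finset.range y, (q ^ (j + 1)) ^ l := by
    rw [h5, pow_mul, mul_neg, mul_neg_geom_sum, neg_sub]
  rw [h7, phiRInf, Nat.add_sub_cancel, Finset.sum_neg_distrib, ← Finset.mul_sum, ← mul_assoc,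
    mul_neg, mul_neg]
  congr 1
  have h8 : ∑ l ∈ Finset.range y, q ^ l * (ν * q ^ l) ^ j =
      ν ^ j * ∑ l ∈ Finset.range y, (q ^ (j + 1)) ^ l := by
    rw [Finset.mul_sum]
    refine Finset.sum_congr rfl fun l _ => ?_
    rw [mul_pow, ← pow_mul, ← pow_mul]
    ring
  rw [h8]
  field_simp

end Rates

/-! ### One step of the chain -/

section ChainLaw

variable {S : Type*}

theorem jumpTime_succ (G : (S → ℝ) → S → ℝ) (ω : (ℕ → S) × (ℕ → ℝ)) (n : ℕ) :
    jumpTime G ω (n + 1) = jumpTime G ω n + ENNReal.ofReal (ω.2 n) / exitRate G (ω.1 n) :=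
  Finset.sum_range_succ _ _

@[simp] theorem jumpTime_zero (G : (S → ℝ) → S → ℝ) (ω : (ℕ → S) × (ℕ → ℝ)) :
    jumpTime G ω 0 = 0 := Finset.sum_range_zero _

theorem jumpTime_mono (G : (S → ℝ) → S → ℝ) (ω : (ℕ → S) × (ℕ → ℝ)) : Monotone (jumpTime G ω) :=
  monotone_nat_of_le_succ fun n => by rw [jumpTime_succ]; exact le_self_add

instance isProbabilityMeasure_expMeasure_one : IsProbabilityMeasure (expMeasure 1) :=
  isProbabilityMeasure_expMeasure one_pos

variable [MeasurableSpace S] [DiscreteMeasurableSpace S]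

instance (G : (S → ℝ) → S → ℝ) (x : S) : IsProbabilityMeasure (chainLaw G x) := by
  unfold chainLaw; infer_instance

/-- The joint law of the first `n` exponential clocks and of the next one. -/
theorem map_infinitePi_restrict_prod (n : ℕ) :
    (Measure.infinitePi (fun _ : ℕ => expMeasure 1)).map
      (fun e => ((Finset.range n).restrict e, e n)) =
    ((Measure.infinitePi (fun _ : ℕ => expMeasure 1)).map (Finset.range n).restrict).prod
      (expMeasure 1) := by
  have hind := iIndepFun_infinitePi (P := fun _ : ℕ => expMeasure 1)
    (X := fun _ (e : ℝ) => e) (fun _ => measurable_id)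
  have h2 : IndepFun (fun (e : ℕ → ℝ) (i : Finset.range n) => e i)
      (fun (e : ℕ → ℝ) (i : ({n} : Finset ℕ)) => e i)
      (Measure.infinitePi (fun _ : ℕ => expMeasure 1)) :=
    hind.indepFun_finset (Finset.range n) {n} (by simp) (fun i => by fun_prop)
  have h3 : IndepFun ((Finset.range n).restrict) (fun e : ℕ → ℝ => e n)
      (Measure.infinitePi (fun _ : ℕ => expMeasure 1)) :=
    h2.comp (φ := id) (ψ := fun f : ({n} : Finset ℕ) → ℝ => f ⟨n, by simp⟩) measurable_id
      (by fun_prop)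
  have h4 := (indepFun_iff_map_prod_eq_prod_map_map (Measurable.aemeasurable (by fun_prop))
    (measurable_pi_apply n).aemeasurable).1 h3
  rw [h4, Measure.infinitePi_map_eval]

/-- The law of the next clock and of the next state, given the current time and state. -/
def stepKernel (G : (S → ℝ) → S → ℝ) : Kernel (ℝ≥0∞ × S) (ℝ × S) :=
  (Kernel.const _ (expMeasure 1)) ×ₖ ((jumpKernel G).comap Prod.snd measurable_snd)

instance (G : (S → ℝ) → S → ℝ) : IsMarkovKernel (stepKernel G) := by
  unfold stepKernel; infer_instance

theorem stepKernel_apply (G : (S → ℝ) → S → ℝ) (p : ℝ≥0∞ × S) :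
    stepKernel G p = (expMeasure 1).prod (jumpKernel G p.2) := by
  rw [stepKernel, Kernel.prod_apply, Kernel.const_apply, Kernel.comap_apply]

/-- The time and the state of the chain after its `n`-th jump. -/
def jumpPoint (G : (S → ℝ) → S → ℝ) (n : ℕ) (ω : (ℕ → S) × (ℕ → ℝ)) : ℝ≥0∞ × S :=
  (jumpTime G ω n, ω.1 n)

theorem measurable_jumpTime (G : (S → ℝ) → S → ℝ) (n : ℕ) :
    Measurable fun ω => jumpTime G ω n := by
  unfold jumpTime
  refine Finset.measurable_sum _ fun i _ => ?_
  have h : Measurable (exitRate G) := .of_discrete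
  exact Measurable.div (by fun_prop) (by fun_prop)

theorem measurable_jumpPoint (G : (S → ℝ) → S → ℝ) (n : ℕ) : Measurable (jumpPoint G n) :=
  (measurable_jumpTime G n).prodMk (by fun_prop)

/-- If the pairs `(a, s)` and `(c, r)` are independent, where `s` has conditional law `κ a` given
`a` and `r` has law `μ` and is independent of `c`, then `(r, s)` has conditional law `μ × κ a` given
`(a, c)`. -/
theorem lintegral_prod_step {Y E A C T : Type*} [MeasurableSpace Y] [MeasurableSpace E]
    [MeasurableSpace A] [MeasurableSpace C] [MeasurableSpace T] {τ : Measure Y} {ε : Measure E}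
    [IsProbabilityMeasure τ] [IsProbabilityMeasure ε] {μ : Measure ℝ} [IsProbabilityMeasure μ]
    {κ : Kernel A T} [IsMarkovKernel κ] {a : Y → A} {s : Y → T} {c : E → C} {r : E → ℝ}
    (ha : Measurable a) (hs : Measurable s) (hc : Measurable c) (hr : Measurable r)
    (hT : (τ.map a) ⊗ₘ κ = τ.map fun y => (a y, s y))
    (hE : ε.map (fun e => (c e, r e)) = (ε.map c).prod μ)
    {F : (A × C) × (ℝ × T) → ℝ≥0∞} (hF : Measurable F) :
    ∫⁻ ω, F ((a ω.1, c ω.2), (r ω.2, s ω.1)) ∂(τ.prod ε) =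
      ∫⁻ ω, ∫⁻ b, F ((a ω.1, c ω.2), b) ∂(μ.prod (κ (a ω.1))) ∂(τ.prod ε) := by
  have : IsProbabilityMeasure (ε.map c) := Measure.isProbabilityMeasure_map hc.aemeasurable
  have hΦ : Measurable fun p : (A × T) × (C × ℝ) => F ((p.1.1, p.2.1), (p.2.2, p.1.2)) :=
    hF.comp (by fun_prop)
  -- both sides equal `∫ a, ∫ s, ∫ (c, r), F`
  calc _ = ∫⁻ y, ∫⁻ e, F ((a y, c e), (r e, s y)) ∂ε ∂τ :=
        lintegral_prod _ (hF.comp (by fun_prop)).aemeasurable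
    _ = ∫⁻ y, ∫⁻ p, F ((a y, p.1), (p.2, s y)) ∂((ε.map c).prod μ) ∂τ := by
        refine lintegral_congr fun y => ?_
        have hm : Measurable fun p : C × ℝ => F ((a y, p.1), (p.2, s y)) := hF.comp (by fun_prop)
        rw [← hE, lintegral_map hm (by fun_prop)]
    _ = ∫⁻ z, ∫⁻ p, F ((z.1, p.1), (p.2, z.2)) ∂((ε.map c).prod μ)
          ∂(τ.map fun y => (a y, s y)) := by
        rw [lintegral_map hΦ.lintegral_prod_right' (by fun_prop)]
    _ = ∫⁻ y, ∫⁻ z, ∫⁻ p, F ((a y, p.1), (p.2, z)) ∂((ε.map c).prod μ) ∂(κ (a y)) ∂τ := by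
        rw [← hT, Measure.lintegral_compProd hΦ.lintegral_prod_right',
          lintegral_map (hΦ.lintegral_prod_right'.lintegral_kernel_prod_right') ha]
    _ = ∫⁻ y, ∫⁻ e, ∫⁻ b, F ((a y, c e), b) ∂(μ.prod (κ (a y))) ∂ε ∂τ := by
        refine lintegral_congr fun y => ?_
        have hy : Measurable fun p : T × (C × ℝ) => F ((a y, p.2.1), (p.2.2, p.1)) :=
          hF.comp (by fun_prop)
        rw [lintegral_lintegral_swap hy.aemeasurable,
          lintegral_prod _ hy.lintegral_prod_left'.aemeasurable,
          lintegral_map hy.lintegral_prod_left'.lintegral_prod_right' hc]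
        refine lintegral_congr fun e => ?_
        have hb : Measurable fun b : ℝ × T => F ((a y, c e), b) := hF.comp (by fun_prop)
        exact (lintegral_prod _ hb.aemeasurable).symm
    _ = _ := by
        symm
        have hG : Measurable fun p : A × C => ∫⁻ b, F (p, b)
            ∂(((Kernel.const _ μ) ×ₖ (κ.comap Prod.fst measurable_fst)) p) :=
          Measurable.lintegral_kernel_prod_right' hF
        simp only [Kernel.prod_apply, Kernel.const_apply, Kernel.comap_apply] at hG
        exact lintegral_prod _ (hG.comp (by fun_prop :
          Measurable fun ω : Y × E => (a ω.1, c ω.2))).aemeasurable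

/-- The Markov property at the `n`-th jump: given the time and the state at that jump, the next
clock and the next state are independent, exponential and distributed as the jump kernel. -/
theorem map_jumpPoint_step (G : (S → ℝ) → S → ℝ) (x : S) (n : ℕ) :
    (chainLaw G x).map (fun ω => (jumpPoint G n ω, (ω.2 n, ω.1 (n + 1)))) =
      ((chainLaw G x).map (jumpPoint G n)) ⊗ₘ stepKernel G := by
  have hexit : Measurable (exitRate G) := .of_discrete
  set τ := Kernel.traj (X := fun _ => S) (jumpStep G) 0 (fun _ => x) with hτ
  set ε := Measure.infinitePi (fun _ : ℕ => expMeasure 1) with hε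
  -- the jump point as a function of the initial segments
  let J : (Π _ : Finset.Iic n, S) × (Finset.range n → ℝ) → ℝ≥0∞ × S := fun p =>
    (∑ i : Finset.range n, ENNReal.ofReal (p.2 i) /
      exitRate G (p.1 ⟨i, Finset.mem_Iic.2 (Finset.mem_range.1 i.2).le⟩),
      p.1 ⟨n, Finset.mem_Iic.2 le_rfl⟩)
  have hJ : Measurable J := by
    refine Measurable.prodMk (Finset.measurable_sum _ fun i _ => ?_) (by fun_prop)
    exact Measurable.div (by fun_prop) (by fun_prop)
  have hJeq : ∀ ω, jumpPoint G n ω =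
      J (Preorder.frestrictLe n ω.1, (Finset.range n).restrict ω.2) := by
    intro ω
    refine Prod.ext ?_ rfl
    change ∑ i ∈ Finset.range n, _ = ∑ i : Finset.range n, _
    rw [← Finset.sum_coe_sort]
    rfl
  have hJ2 : ∀ (a : Π _ : Finset.Iic n, S) (c : Finset.range n → ℝ),
      (J (a, c)).2 = a ⟨n, Finset.mem_Iic.2 le_rfl⟩ := fun _ _ => rfl
  clear_value J
  have hT : (τ.map (Preorder.frestrictLe n)) ⊗ₘ (jumpStep G n) =
      τ.map (fun y => (Preorder.frestrictLe n y, y (n + 1))) := by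
    rw [← Kernel.partialTraj_compProd_eq_map_traj (Nat.zero_le n),
      Kernel.traj_map_frestrictLe_apply]
  have hE := map_infinitePi_restrict_prod n
  rw [← hε] at hE
  refine Measure.ext_of_lintegral _ fun F hF => ?_
  have hjp := measurable_jumpPoint G n
  rw [lintegral_map hF (by fun_prop), Measure.lintegral_compProd hF,
    lintegral_map (by fun_prop) hjp]
  have key := lintegral_prod_step (τ := τ) (ε := ε) (Preorder.measurable_frestrictLe n)
    (measurable_pi_apply (n + 1)) (by fun_prop) (measurable_pi_apply n) hT hE
    (F := fun r => F (J r.1, r.2)) (hF.comp (by fun_prop))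
  simp only [hJeq, stepKernel_apply, hJ2]
  exact key

end ChainLaw

/-! ### Nonexplosion -/

section Nonexplosion

variable {S : Type*} [MeasurableSpace S] [DiscreteMeasurableSpace S]

theorem ae_fst_zero_eq (G : (S → ℝ) → S → ℝ) (x : S) : ∀ᵐ ω ∂chainLaw G x, ω.1 0 = x := by
  have h1 : (chainLaw G x).map (fun ω => ω.1 0) = Measure.dirac x := by
    have h2 : (chainLaw G x).map Prod.fst =
        Kernel.traj (X := fun _ => S) (jumpStep G) 0 (fun _ => x) := by
      unfold chainLaw
      rw [Measure.map_fst_prod]; simp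
    have h3 : (fun ω : (ℕ → S) × (ℕ → ℝ) => ω.1 0) =
        (fun a : (Π _ : Finset.Iic 0, S) => a ⟨0, Finset.mem_Iic.2 le_rfl⟩) ∘
          (Preorder.frestrictLe 0) ∘ Prod.fst := rfl
    rw [h3, ← Measure.map_map (by fun_prop) (by fun_prop), ← Measure.map_map (by fun_prop)
      (by fun_prop), h2, Kernel.traj_map_frestrictLe_apply, Kernel.partialTraj_self,
      Kernel.id_apply, Measure.map_dirac' (by fun_prop)]
  have h4 : ∀ᵐ y ∂((chainLaw G x).map fun ω => ω.1 0), y = x := by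
    rw [h1, ae_dirac_iff (MeasurableSet.of_discrete (s := {y | y = x}))]
  exact ae_of_ae_map (by fun_prop) h4

theorem lintegral_jumpPoint_step (G : (S → ℝ) → S → ℝ) (x : S) (n : ℕ)
    {F : (ℝ≥0∞ × S) × (ℝ × S) → ℝ≥0∞} (hF : Measurable F) :
    ∫⁻ ω, F (jumpPoint G n ω, (ω.2 n, ω.1 (n + 1))) ∂chainLaw G x =
      ∫⁻ ω, ∫⁻ b, F (jumpPoint G n ω, b) ∂((expMeasure 1).prod (jumpKernel G (ω.1 n)))
        ∂chainLaw G x := by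
  have hjp := measurable_jumpPoint G n
  have h := congrArg (fun μ => ∫⁻ p, F p ∂μ) (map_jumpPoint_step G x n)
  rw [lintegral_map hF (by fun_prop), Measure.lintegral_compProd hF,
    lintegral_map (by fun_prop) hjp] at h
  simp only [stepKernel_apply] at h
  exact h

/-- A set of states that the jump kernel does not leave is almost surely never left. -/
theorem ae_forall_mem {G : (S → ℝ) → S → ℝ} {A : Set S}
    (hA : ∀ y ∈ A, ∀ᵐ z ∂jumpKernel G y, z ∈ A) {x : S} (hx : x ∈ A) :
    ∀ᵐ ω ∂chainLaw G x, ∀ n, ω.1 n ∈ A := by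
  rw [ae_all_iff]
  intro n
  induction n with
  | zero => filter_upwards [ae_fst_zero_eq G x] with ω h; rwa [h]
  | succ n ih =>
    have hm : Measurable fun p : (ℝ≥0∞ × S) × (ℝ × S) => Aᶜ.indicator (1 : S → ℝ≥0∞) p.2.2 :=
      (Measurable.of_discrete (f := Aᶜ.indicator (1 : S → ℝ≥0∞))).comp (by fun_prop)
    have h1 := lintegral_jumpPoint_step G x n hm
    have h2 : ∫⁻ ω, ∫⁻ b : ℝ × S, Aᶜ.indicator (1 : S → ℝ≥0∞) b.2
        ∂((expMeasure 1).prod (jumpKernel G (ω.1 n))) ∂chainLaw G x = 0 := by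
      rw [lintegral_eq_zero_iff' (by
        have := (Measurable.lintegral_kernel_prod_right' (κ := stepKernel G) hm).comp
          (measurable_jumpPoint G n)
        simp only [stepKernel_apply] at this
        exact this.aemeasurable)]
      filter_upwards [ih] with ω hω
      have hm' : Measurable fun b : ℝ × S => Aᶜ.indicator (1 : S → ℝ≥0∞) b.2 :=
        (Measurable.of_discrete (f := Aᶜ.indicator (1 : S → ℝ≥0∞))).comp (by fun_prop)
      rw [lintegral_prod _ hm'.aemeasurable]
      have h3 : ∫⁻ z, Aᶜ.indicator (1 : S → ℝ≥0∞) z ∂jumpKernel G (ω.1 n) = 0 := by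
        rw [lintegral_eq_zero_iff' Measurable.of_discrete.aemeasurable]
        filter_upwards [hA _ hω] with z hz
        simp [hz]
      simp [h3]
    have hm2 : Measurable fun ω : (ℕ → S) × (ℕ → ℝ) =>
        Aᶜ.indicator (1 : S → ℝ≥0∞) (ω.1 (n + 1)) :=
      (Measurable.of_discrete (f := Aᶜ.indicator (1 : S → ℝ≥0∞))).comp (by fun_prop)
    rw [h2] at h1
    replace h1 := (lintegral_eq_zero_iff' hm2.aemeasurable).1 h1
    filter_upwards [h1] with ω hω
    by_contra hcon
    simp [hcon] at hω

theorem ae_expMeasure_pos : ∀ᵐ s ∂expMeasure 1, 0 < s := by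
  have h : expMeasure 1 = volume.withDensity (exponentialPDF 1) := rfl
  rw [h, ae_withDensity_iff (by exact (measurable_exponentialPDFReal 1).ennreal_ofReal)]
  filter_upwards [Measure.ae_ne volume (0 : ℝ)] with s hs h0
  by_contra hcon
  exact h0 (exponentialPDF_of_neg (lt_of_le_of_ne (not_lt.1 hcon) hs))

/-- The discount factor `exp (-θ j)`, with value `0` for `j = ∞`. -/
def discount (θ : ℝ) (j : ℝ≥0∞) : ℝ≥0∞ :=
  if j = ∞ then 0 else ENNReal.ofReal (Real.exp (-(θ * j.toReal)))

theorem measurable_discount (θ : ℝ) : Measurable (discount θ) := by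
  unfold discount
  refine Measurable.ite (measurableSet_singleton _) measurable_const ?_
  fun_prop

theorem discount_add (θ : ℝ) (j a : ℝ≥0∞) : discount θ (j + a) = discount θ j * discount θ a := by
  unfold discount
  by_cases hj : j = ∞
  · simp [hj]
  by_cases ha : a = ∞
  · simp [ha]
  rw [if_neg hj, if_neg ha, if_neg (by simp [hj, ha]), ENNReal.toReal_add hj ha,
    ← ENNReal.ofReal_mul (Real.exp_pos _).le, ← Real.exp_add]
  congr 2
  ring

theorem discount_le_one {θ : ℝ} (hθ : 0 < θ) (j : ℝ≥0∞) : discount θ j ≤ 1 := by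
  unfold discount
  split_ifs
  · exact zero_le_one
  · refine ENNReal.ofReal_le_one.2 (Real.exp_le_one_iff.2 ?_)
    have := mul_nonneg hθ.le j.toReal_nonneg
    linarith

/-- The Laplace transform of the holding time in a state with exit rate `a`. -/
theorem lintegral_discount_holding_le {θ : ℝ} (hθ : 0 < θ) {a : ℝ≥0∞} (ha : a ≠ ∞) :
    ∫⁻ s, discount θ (ENNReal.ofReal s / a) ∂expMeasure 1 ≤ a / (a + ENNReal.ofReal θ) := by
  rcases eq_or_ne a 0 with rfl | ha0
  · refine (lintegral_eq_zero_iff' ?_).2 ?_ |>.trans_le zero_le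
    · exact ((measurable_discount θ).comp (by fun_prop)).aemeasurable
    · filter_upwards [ae_expMeasure_pos] with s hs
      rw [ENNReal.div_zero (by simpa using hs)]
      simp [discount]
  obtain ⟨l, rfl⟩ : ∃ l : ℝ, a = ENNReal.ofReal l := ⟨a.toReal, (ENNReal.ofReal_toReal ha).symm⟩
  have hl : 0 < l := by simpa using ha0
  have hr : 0 < 1 + θ / l := by positivity
  have hm : Measurable fun s => discount θ (ENNReal.ofReal s / ENNReal.ofReal l) :=
    (measurable_discount θ).comp (by fun_prop)
  have h : expMeasure 1 = volume.withDensity (exponentialPDF 1) := rfl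
  rw [h, lintegral_withDensity_eq_lintegral_mul _
    (by exact (measurable_exponentialPDFReal 1).ennreal_ofReal) hm]
  have h1 : ∀ s, (exponentialPDF 1 * fun s => discount θ (ENNReal.ofReal s / ENNReal.ofReal l)) s =
      ENNReal.ofReal (1 + θ / l)⁻¹ * exponentialPDF (1 + θ / l) s := by
    intro s
    rw [Pi.mul_apply]
    rcases lt_or_ge s 0 with hs | hs
    · simp [exponentialPDF_of_neg hs]
    · rw [exponentialPDF_of_nonneg hs, exponentialPDF_of_nonneg hs,
        ← ENNReal.ofReal_div_of_pos hl, discount, if_neg ENNReal.ofReal_ne_top,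
        ENNReal.toReal_ofReal (by positivity), ← ENNReal.ofReal_mul (by positivity),
        ← ENNReal.ofReal_mul (by positivity)]
      congr 1
      rw [← mul_assoc, inv_mul_cancel₀ hr.ne', one_mul, one_mul, one_mul, ← Real.exp_add]
      congr 1
      ring
  simp only [h1]
  rw [lintegral_const_mul _ (by exact (measurable_exponentialPDFReal _).ennreal_ofReal),
    lintegral_exponentialPDF_eq_one hr, mul_one, ← ENNReal.ofReal_add hl.le hθ.le,
    ← ENNReal.ofReal_div_of_pos (by positivity)]
  refine le_of_eq ?_
  congr 1
  field_simp

/-- The bound `min 1 (ε V + ρ ^ m)` for the expected discount factor after `m` jumps. -/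
def discountBound (V : S → ℝ≥0∞) (ε ρ : ℝ≥0∞) (m : ℕ) (y : S) : ℝ≥0∞ := min 1 (ε * V y + ρ ^ m)

/-- The expected discount factor at the `n`-th jump is at most `min 1 (ε V x + ρ ^ n)`: the drift
bound controls the states where `V` is large, and elsewhere each jump gains a factor `ρ`. -/
theorem lintegral_discount_jumpTime_le {G : (S → ℝ) → S → ℝ} {A : Set S}
    (hA : ∀ y ∈ A, ∀ᵐ z ∂jumpKernel G y, z ∈ A) {V : S → ℝ≥0∞} {θ : ℝ} (hθ : 0 < θ)
    (hfin : ∀ y ∈ A, exitRate G y ≠ ∞)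
    (hdrift : ∀ y ∈ A, exitRate G y * ∫⁻ z, V z ∂jumpKernel G y ≤
      (exitRate G y + ENNReal.ofReal θ) * V y)
    {ε ρ : ℝ≥0∞} (hρ : ∀ y ∈ A, ε * V y < 1 → exitRate G y / (exitRate G y + ENNReal.ofReal θ) ≤ ρ)
    {x : S} (hx : x ∈ A) (n : ℕ) :
    ∫⁻ ω, discount θ (jumpTime G ω n) ∂chainLaw G x ≤ discountBound V ε ρ n x := by
  have hθ' : ENNReal.ofReal θ ≠ 0 := by simpa using hθ
  have hstep : ∀ m, ∀ y ∈ A, (∫⁻ s, discount θ (ENNReal.ofReal s / exitRate G y) ∂expMeasure 1) *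
      ∫⁻ z, discountBound V ε ρ m z ∂jumpKernel G y ≤ discountBound V ε ρ (m + 1) y := by
    intro m y hy
    have h1 := lintegral_discount_holding_le hθ (hfin y hy)
    have hfy := hfin y hy
    set a := exitRate G y with ha
    set b := a + ENNReal.ofReal θ with hb
    have hb0 : b ≠ 0 := by simp [hb, hθ]
    have hbt : b ≠ ∞ := by rw [hb]; exact ENNReal.add_ne_top.2 ⟨hfy, ENNReal.ofReal_ne_top⟩
    have hab : a / b ≤ 1 := ENNReal.div_le_of_le_mul (by rw [one_mul]; exact le_self_add)
    have hone : ∫⁻ z, discountBound V ε ρ m z ∂jumpKernel G y ≤ 1 := by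
      calc _ ≤ ∫⁻ z, 1 ∂jumpKernel G y := lintegral_mono fun z => min_le_left _ _
        _ = 1 := by simp
    refine le_min ((mul_le_mul' (h1.trans hab) hone).trans (by simp)) ?_
    rcases lt_or_ge (ε * V y) 1 with hV | hV
    · calc _ ≤ a / b * ∫⁻ z, (ε * V z + ρ ^ m) ∂jumpKernel G y :=
            mul_le_mul' h1 (lintegral_mono fun z => min_le_right _ _)
        _ = ε * ((a * ∫⁻ z, V z ∂jumpKernel G y) / b) + a / b * ρ ^ m := by
            rw [lintegral_add_right _ measurable_const, lintegral_const_mul _ .of_discrete,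
              lintegral_const, measure_univ, mul_one, mul_add]
            simp only [div_eq_mul_inv]
            ring
        _ ≤ ε * V y + ρ * ρ ^ m := by
            gcongr
            · refine ENNReal.div_le_of_le_mul ?_
              rw [mul_comm (V y)]
              exact hdrift y hy
            · exact hρ y hy hV
        _ = _ := by rw [pow_succ']
    · exact (mul_le_mul' (h1.trans hab) hone).trans (by rw [mul_one]; exact hV.trans le_self_add)
  have hmem := ae_forall_mem hA hx
  -- the bound at the `n`-th jump is carried back to time `0`, one jump at a time
  have main : ∀ m k, m + k = n → ∫⁻ ω, discount θ (jumpTime G ω m) * discountBound V ε ρ k (ω.1 m)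
      ∂chainLaw G x ≤ discountBound V ε ρ n x := by
    intro m
    induction m with
    | zero =>
      intro k hk
      obtain rfl : k = n := by omega
      calc _ ≤ ∫⁻ ω, discountBound V ε ρ k x ∂chainLaw G x := by
            refine lintegral_mono_ae ?_
            filter_upwards [ae_fst_zero_eq G x] with ω hω
            rw [hω]
            exact (mul_le_mul' (discount_le_one hθ _) le_rfl).trans (by simp)
        _ = _ := by simp
    | succ m ih =>
      intro k hk
      refine le_trans ?_ (ih (k + 1) (by omega))
      have hb : Measurable (discountBound V ε ρ k) := .of_discrete
      have he : Measurable (exitRate G) := .of_discrete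
      have hd := measurable_discount θ
      have hF : Measurable fun p : (ℝ≥0∞ × S) × (ℝ × S) =>
          discount θ (p.1.1 + ENNReal.ofReal p.2.1 / exitRate G p.1.2) *
            discountBound V ε ρ k p.2.2 := by
        refine Measurable.mul (hd.comp (Measurable.add (by fun_prop) ?_)) (by fun_prop)
        exact Measurable.div (by fun_prop) (by fun_prop)
      have h1 := lintegral_jumpPoint_step G x m hF
      simp only [jumpPoint, ← jumpTime_succ] at h1
      rw [h1]
      refine lintegral_mono_ae ?_
      filter_upwards [hmem] with ω hω
      calc _ = ∫⁻ b : ℝ × S, discount θ (jumpTime G ω m) *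
            (discount θ (ENNReal.ofReal b.1 / exitRate G (ω.1 m)) * discountBound V ε ρ k b.2)
              ∂((expMeasure 1).prod (jumpKernel G (ω.1 m))) := by
            refine lintegral_congr fun b => ?_
            rw [discount_add, mul_assoc]
        _ = discount θ (jumpTime G ω m) *
            ((∫⁻ s, discount θ (ENNReal.ofReal s / exitRate G (ω.1 m)) ∂expMeasure 1) *
              ∫⁻ z, discountBound V ε ρ k z ∂jumpKernel G (ω.1 m)) := by
            have hm : Measurable fun s =>
                discount θ (ENNReal.ofReal s / exitRate G (ω.1 m)) := hd.comp (by fun_prop)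
            rw [lintegral_const_mul _ (by fun_prop), lintegral_prod_mul hm.aemeasurable
              hb.aemeasurable]
        _ ≤ _ := mul_le_mul' le_rfl (hstep k _ (hω m))
  have h0 : discountBound V ε ρ 0 = 1 := by
    ext y; simp [discountBound]
  simpa [h0] using main n 0 rfl

/-- A chain with a Lyapunov function `V` whose sublevel sets have bounded exit rates does not
explode. -/
theorem tendsto_measure_jumpTime_le {G : (S → ℝ) → S → ℝ} {A : Set S}
    (hA : ∀ y ∈ A, ∀ᵐ z ∂jumpKernel G y, z ∈ A) {V : S → ℝ≥0∞} {θ : ℝ} (hθ : 0 < θ)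
    (hfin : ∀ y ∈ A, exitRate G y ≠ ∞) (hVfin : ∀ y ∈ A, V y ≠ ∞)
    (hdrift : ∀ y ∈ A, exitRate G y * ∫⁻ z, V z ∂jumpKernel G y ≤
      (exitRate G y + ENNReal.ofReal θ) * V y)
    (hbdd : ∀ M : ℝ≥0∞, M ≠ ∞ → ∃ Λ : ℝ≥0∞, Λ ≠ ∞ ∧ ∀ y ∈ A, V y ≤ M → exitRate G y ≤ Λ)
    {x : S} (hx : x ∈ A) {t : ℝ} (ht : 0 ≤ t) :
    Tendsto (fun n => chainLaw G x {ω | jumpTime G ω n ≤ ENNReal.ofReal t}) atTop (𝓝 0) := by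
  have hθ' : ENNReal.ofReal θ ≠ 0 := by simpa using hθ
  set K := ENNReal.ofReal (Real.exp (θ * t)) with hK
  have hmarkov : ∀ n, chainLaw G x {ω | jumpTime G ω n ≤ ENNReal.ofReal t} ≤
      K * ∫⁻ ω, discount θ (jumpTime G ω n) ∂chainLaw G x := by
    intro n
    have hms : MeasurableSet {ω | jumpTime G ω n ≤ ENNReal.ofReal t} :=
      measurableSet_le (measurable_jumpTime G n) measurable_const
    rw [← lintegral_indicator_one hms, ← lintegral_const_mul' _ _ ENNReal.ofReal_ne_top]
    refine lintegral_mono fun ω => ?_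
    by_cases h : jumpTime G ω n ≤ ENNReal.ofReal t
    · rw [indicator_of_mem (by exact h), discount,
        if_neg (h.trans_lt ENNReal.ofReal_lt_top).ne, ← ENNReal.ofReal_mul (Real.exp_pos _).le,
        ← Real.exp_add, Pi.one_apply, ENNReal.one_le_ofReal]
      refine Real.one_le_exp ?_
      have h2 := ENNReal.toReal_mono ENNReal.ofReal_ne_top h
      rw [ENNReal.toReal_ofReal ht] at h2
      nlinarith
    · rw [indicator_of_notMem (by exact h)]
      exact zero_le
  rw [ENNReal.tendsto_nhds_zero]
  intro δ hδ
  have hδ2 : δ / 2 ≠ 0 := (ENNReal.half_pos hδ.ne').ne'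
  have hKt : K ≠ ∞ := ENNReal.ofReal_ne_top
  obtain ⟨ε, hε0, hε⟩ : ∃ ε : NNReal, 0 < ε ∧ (ε : ℝ≥0∞) * (K * V x) < δ / 2 :=
    ENNReal.exists_nnreal_pos_mul_lt (ENNReal.mul_ne_top hKt (hVfin x hx)) hδ2
  obtain ⟨Λ, hΛ, hΛb⟩ := hbdd (ε : ℝ≥0∞)⁻¹ (by simp [hε0.ne'])
  set ρ := Λ / (Λ + ENNReal.ofReal θ) with hρ
  have hρ1 : ρ < 1 := by
    rw [hρ, ENNReal.div_lt_iff (Or.inl (by simp [hθ])) (Or.inl (by simp [hΛ])), one_mul]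
    exact ENNReal.lt_add_right hΛ hθ'
  have hρb : ∀ y ∈ A, (ε : ℝ≥0∞) * V y < 1 →
      exitRate G y / (exitRate G y + ENNReal.ofReal θ) ≤ ρ := by
    intro y hy hV
    have h1 : exitRate G y ≤ Λ := by
      refine hΛb y hy ?_
      rw [← one_div]
      refine (ENNReal.le_div_iff_mul_le (Or.inl (by simp [hε0.ne'])) (Or.inl (by simp))).2 ?_
      rw [mul_comm]; exact hV.le
    have hb0 : Λ + ENNReal.ofReal θ ≠ 0 := by simp [hθ]
    have hbt : Λ + ENNReal.ofReal θ ≠ ∞ := ENNReal.add_ne_top.2 ⟨hΛ, ENNReal.ofReal_ne_top⟩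
    refine ENNReal.div_le_of_le_mul ?_
    calc exitRate G y = Λ / (Λ + ENNReal.ofReal θ) * exitRate G y +
          ENNReal.ofReal θ / (Λ + ENNReal.ofReal θ) * exitRate G y := by
          rw [← add_mul, ENNReal.div_add_div_same, ENNReal.div_self hb0 hbt, one_mul]
      _ ≤ Λ / (Λ + ENNReal.ofReal θ) * exitRate G y +
          ENNReal.ofReal θ / (Λ + ENNReal.ofReal θ) * Λ := by gcongr
      _ = ρ * (exitRate G y + ENNReal.ofReal θ) := by
          rw [hρ, mul_add]
          simp only [div_eq_mul_inv]
          ring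
  have hpow : Tendsto (fun n => K * ρ ^ n) atTop (𝓝 0) := by
    have := ENNReal.Tendsto.const_mul (a := K) (ENNReal.tendsto_pow_atTop_nhds_zero_of_lt_one hρ1)
      (Or.inr hKt)
    simpa using this
  filter_upwards [(ENNReal.tendsto_nhds_zero.1 hpow) (δ / 2) (pos_iff_ne_zero.2 hδ2)] with n hn
  calc _ ≤ K * discountBound V ε ρ n x := (hmarkov n).trans (mul_le_mul' le_rfl
        (lintegral_discount_jumpTime_le hA hθ hfin hdrift hρb hx n))
    _ ≤ K * (ε * V x + ρ ^ n) := mul_le_mul' le_rfl (min_le_right _ _)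
    _ = ε * (K * V x) + K * ρ ^ n := by ring
    _ ≤ δ / 2 + δ / 2 := add_le_add hε.le hn
    _ = δ := ENNReal.add_halves δ

end Nonexplosion

/-! ### The backward equation -/

section Backward

theorem integral_expMeasure_one (g : ℝ → ℝ) :
    ∫ s, g s ∂expMeasure 1 = ∫ s in Ioi 0, Real.exp (-s) * g s := by
  have h : expMeasure 1 = volume.withDensity fun s => ENNReal.ofReal (exponentialPDFReal 1 s) := rfl
  rw [h, integral_withDensity_eq_integral_toReal_smul
    (measurable_exponentialPDFReal 1).ennreal_ofReal (by simp), ← integral_Ici_eq_integral_Ioi,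
    ← integral_indicator measurableSet_Ici]
  refine integral_congr_ae (.of_forall fun s => ?_)
  dsimp only
  rw [ENNReal.toReal_ofReal (exponentialPDFReal_nonneg one_pos s), smul_eq_mul]
  rcases lt_or_ge s 0 with hs | hs
  · rw [indicator_of_notMem (by simpa using hs)]
    simp [exponentialPDFReal, gammaPDFReal, not_le.2 hs]
  · rw [indicator_of_mem (by simpa using hs)]
    simp [exponentialPDFReal, gammaPDFReal, hs]

/-- The renewal identity at an exponential time: `e^{-s}` times the combination `u + u' / l`
along `s ↦ r - s / l` has the primitive `-e^{-s} u (r - s / l)`. -/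
theorem integral_expMeasure_renewal {u u' : ℝ → ℝ} (hu : ∀ s, HasDerivAt u (u' s) s)
    (hu' : Continuous u') {l r : ℝ} (hl : 0 < l) (hr : 0 ≤ r) :
    ∫ s, (if s ≤ l * r then u (r - s / l) + u' (r - s / l) / l else u 0) ∂expMeasure 1 = u r := by
  have hlr : 0 ≤ l * r := mul_nonneg hl.le hr
  have hcont : Continuous u := continuous_iff_continuousAt.2 fun s => (hu s).continuousAt
  rw [integral_expMeasure_one]
  have hsplit : Ioi (0 : ℝ) = Ioc 0 (l * r) ∪ Ioi (l * r) := (Ioc_union_Ioi_eq_Ioi hlr).symm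
  have hc : Continuous fun s => Real.exp (-s) * (u (r - s / l) + u' (r - s / l) / l) := by
    fun_prop
  have h1 : EqOn (fun s => Real.exp (-s) * (if s ≤ l * r then u (r - s / l) + u' (r - s / l) / l
      else u 0)) (fun s => Real.exp (-s) * (u (r - s / l) + u' (r - s / l) / l))
      (Ioc 0 (l * r)) := by
    intro s hs; simp only [if_pos hs.2]
  have h2 : EqOn (fun s => Real.exp (-s) * (if s ≤ l * r then u (r - s / l) + u' (r - s / l) / l
      else u 0)) (fun s => Real.exp (-s) * u 0) (Ioi (l * r)) := by
    intro s hs; simp only [if_neg (not_le.2 (mem_Ioi.1 hs))]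
  have i1 : IntegrableOn (fun s => Real.exp (-s) * (u (r - s / l) + u' (r - s / l) / l))
      (Ioc 0 (l * r)) := (hc.integrableOn_Icc).mono_set Ioc_subset_Icc_self
  have i2 : IntegrableOn (fun s => Real.exp (-s) * u 0) (Ioi (l * r)) :=
    (integrableOn_exp_neg_Ioi _).mul_const _
  rw [hsplit, setIntegral_union Ioc_disjoint_Ioi_same measurableSet_Ioi
    (i1.congr_fun h1.symm measurableSet_Ioc) (i2.congr_fun h2.symm measurableSet_Ioi),
    setIntegral_congr_fun measurableSet_Ioc h1, setIntegral_congr_fun measurableSet_Ioi h2,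
    ← intervalIntegral.integral_of_le hlr, integral_mul_const, integral_exp_neg_Ioi]
  have hd : ∀ s ∈ uIcc 0 (l * r), HasDerivAt (fun s => -(Real.exp (-s) * u (r - s / l)))
      (Real.exp (-s) * (u (r - s / l) + u' (r - s / l) / l)) s := by
    intro s _
    have e1 : HasDerivAt (fun s : ℝ => r - s / l) (-(1 / l)) s :=
      ((hasDerivAt_id s).div_const l).const_sub r
    have e2 := (hu (r - s / l)).comp s e1
    have e3 : HasDerivAt (fun s : ℝ => Real.exp (-s)) (Real.exp (-s) * -1) s :=
      (hasDerivAt_neg s).exp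
    refine (e3.mul e2).neg.congr_deriv ?_
    simp only [Function.comp_apply]
    ring
  rw [intervalIntegral.integral_eq_sub_of_hasDerivAt hd (hc.intervalIntegrable _ _)]
  rw [mul_div_cancel_left₀ _ hl.ne']
  simp

variable {S : Type*}

/-- The value `w (t - j, y)` if the time `j` is at most `t`, and `0` otherwise. -/
def remaining (w : ℝ → S → ℝ) (t : ℝ) (p : ℝ≥0∞ × S) : ℝ :=
  if p.1 ≤ ENNReal.ofReal t then w (t - p.1.toReal) p.2 else 0

/-- The value `f y` if the time `t` lies in `[j, j')`, and `0` otherwise. -/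
def onInterval (f : S → ℝ) (t : ℝ) (j j' : ℝ≥0∞) (y : S) : ℝ :=
  if j ≤ ENNReal.ofReal t ∧ ENNReal.ofReal t < j' then f y else 0

theorem sum_onInterval (G : (S → ℝ) → S → ℝ) (f : S → ℝ) (t : ℝ) (ω : (ℕ → S) × (ℕ → ℝ)) (n : ℕ) :
    ∑ i ∈ Finset.range n, onInterval f t (jumpTime G ω i) (jumpTime G ω (i + 1)) (ω.1 i) =
      if jumpTime G ω n ≤ ENNReal.ofReal t then 0 else observe G t f ω := by
  classical
  have hmono := jumpTime_mono G ω
  by_cases h : jumpTime G ω n ≤ ENNReal.ofReal t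
  · rw [if_pos h]
    refine Finset.sum_eq_zero fun i hi => if_neg fun h' => ?_
    exact (not_lt.2 ((hmono (Finset.mem_range.1 hi)).trans h)) h'.2
  · rw [if_neg h]
    have hex : ∃ m, jumpTime G ω m ≤ ENNReal.ofReal t ∧
        ENNReal.ofReal t < jumpTime G ω (m + 1) := by
      by_contra hcon
      push Not at hcon
      refine h ?_
      clear h
      induction n with
      | zero => simp
      | succ n ih => exact hcon n ih
    obtain ⟨m, hm⟩ := id hex
    have huniq : ∀ i, (jumpTime G ω i ≤ ENNReal.ofReal t ∧
        ENNReal.ofReal t < jumpTime G ω (i + 1)) → i = m := by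
      intro i hi
      by_contra hne
      rcases lt_or_gt_of_ne hne with hlt | hlt
      · exact (not_lt.2 ((hmono (Nat.succ_le_of_lt hlt)).trans hm.1)) hi.2
      · exact (not_lt.2 ((hmono (Nat.succ_le_of_lt hlt)).trans hi.1)) hm.2
    have hmn : m < n := by
      by_contra hcon
      exact h ((hmono (not_lt.1 hcon)).trans hm.1)
    have hobs : observe G t f ω = f (ω.1 m) := by
      unfold observe stateAt
      rw [dif_pos hex, Option.elim_some]
      rw [huniq _ (Nat.find_spec hex)]
    rw [hobs, Finset.sum_eq_single m]
    · exact if_pos hm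
    · intro i _ hi
      exact if_neg fun h' => hi (huniq i h')
    · intro h'
      exact absurd (Finset.mem_range.2 hmn) h'

variable [MeasurableSpace S] [DiscreteMeasurableSpace S]

/-- The data of a bounded solution `w` of the backward equation, with time derivative `w'`. The
bound is required only on the set `A` of states, for times in `[0, t]`. -/
structure SolvesBackward (G : (S → ℝ) → S → ℝ) (A : Set S) (t M : ℝ) (w w' : ℝ → S → ℝ) :
    Prop where
  bound : ∀ s ∈ Icc 0 t, ∀ y ∈ A, |w s y| ≤ M
  hasDerivAt : ∀ y s, HasDerivAt (fun s => w s y) (w' s y) s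
  continuous : ∀ y, Continuous fun s => w' s y
  eq : ∀ y ∈ A, ∀ s ∈ Icc 0 t,
    w' s y = (exitRate G y).toReal * (∫ z, w s z ∂jumpKernel G y - w s y)

variable {G : (S → ℝ) → S → ℝ} {A : Set S} {t M : ℝ} {w w' : ℝ → S → ℝ}

theorem SolvesBackward.measurable [Countable S] (hw : SolvesBackward G A t M w w') :
    Measurable fun p : ℝ × S => w p.1 p.2 :=
  measurable_from_prod_countable_left fun y =>
    (continuous_iff_continuousAt.2 fun s => (hw.hasDerivAt y s).continuousAt).measurable

theorem SolvesBackward.measurable_remaining [Countable S] (hw : SolvesBackward G A t M w w') :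
    Measurable (remaining w t) := by
  refine Measurable.ite (measurableSet_le measurable_fst measurable_const) ?_ measurable_const
  exact hw.measurable.comp (by fun_prop : Measurable fun p : ℝ≥0∞ × S => (t - p.1.toReal, p.2))

theorem measurable_onInterval (f : S → ℝ) (t : ℝ) :
    Measurable fun p : (ℝ≥0∞ × ℝ≥0∞) × S => onInterval f t p.1.1 p.1.2 p.2 := by
  have hf : Measurable f := .of_discrete
  refine Measurable.ite ?_ (by fun_prop) measurable_const
  exact (measurableSet_le (measurable_fst.comp measurable_fst) measurable_const).inter
    (measurableSet_lt measurable_const (measurable_snd.comp measurable_fst))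

theorem SolvesBackward.abs_remaining_le (hw : SolvesBackward G A t M w w') (hM : 0 ≤ M)
    (ht : 0 ≤ t) (j : ℝ≥0∞) {y : S} (hy : y ∈ A) : |remaining w t (j, y)| ≤ M := by
  unfold remaining
  split_ifs with h
  · have h2 := ENNReal.toReal_mono ENNReal.ofReal_ne_top h
    rw [ENNReal.toReal_ofReal ht] at h2
    exact hw.bound _ ⟨sub_nonneg.2 h2, by linarith [@ENNReal.toReal_nonneg j]⟩ y hy
  · simpa using hM

/-- Averaging over one jump: the solution at the remaining time is the expected value of the
solution after the next jump, or of the initial data if the next jump comes too late. -/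
theorem SolvesBackward.integral_step [Countable S] (hw : SolvesBackward G A t M w w')
    (hM : 0 ≤ M) (ht : 0 ≤ t)
    (hA : ∀ y ∈ A, ∀ᵐ z ∂jumpKernel G y, z ∈ A) (hfin : ∀ y ∈ A, exitRate G y ≠ ∞)
    (j : ℝ≥0∞) {y : S} (hy : y ∈ A) :
    Integrable (fun b : ℝ × S => onInterval (w 0) t j (j + ENNReal.ofReal b.1 / exitRate G y) y +
      remaining w t (j + ENNReal.ofReal b.1 / exitRate G y, b.2))
        ((expMeasure 1).prod (jumpKernel G y)) ∧
    ∫ b : ℝ × S, (onInterval (w 0) t j (j + ENNReal.ofReal b.1 / exitRate G y) y +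
      remaining w t (j + ENNReal.ofReal b.1 / exitRate G y, b.2))
        ∂((expMeasure 1).prod (jumpKernel G y)) = remaining w t (j, y) := by
  set a := exitRate G y with ha
  have hma : Measurable fun s : ℝ => j + ENNReal.ofReal s / a :=
    Measurable.add measurable_const (by fun_prop)
  have hmeas : Measurable fun b : ℝ × S => onInterval (w 0) t j (j + ENNReal.ofReal b.1 / a) y +
      remaining w t (j + ENNReal.ofReal b.1 / a, b.2) := by
    refine Measurable.add ?_ (hw.measurable_remaining.comp
      ((hma.comp measurable_fst).prodMk measurable_snd))
    exact (measurable_onInterval (w 0) t).comp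
      ((measurable_const.prodMk (hma.comp measurable_fst)).prodMk measurable_const)
  have hAae : ∀ᵐ b ∂((expMeasure 1).prod (jumpKernel G y)), b.2 ∈ A :=
    Measure.quasiMeasurePreserving_snd.ae (hA y hy)
  have hint : Integrable (fun b : ℝ × S => onInterval (w 0) t j (j + ENNReal.ofReal b.1 / a) y +
      remaining w t (j + ENNReal.ofReal b.1 / a, b.2)) ((expMeasure 1).prod (jumpKernel G y)) := by
    refine Integrable.of_bound hmeas.aestronglyMeasurable (M + M) ?_
    filter_upwards [hAae] with b hb
    refine (norm_add_le _ _).trans (add_le_add ?_ (hw.abs_remaining_le hM ht _ hb))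
    unfold onInterval
    split_ifs
    · exact hw.bound 0 ⟨le_rfl, ht⟩ y hy
    · simpa using hM
  refine ⟨hint, ?_⟩
  by_cases hj : j ≤ ENNReal.ofReal t
  swap
  · have h0 : remaining w t (j, y) = 0 := if_neg hj
    rw [h0]
    refine integral_eq_zero_of_ae (.of_forall fun b => ?_)
    have h1 : ¬ j + ENNReal.ofReal b.1 / a ≤ ENNReal.ofReal t := fun h =>
      hj (le_self_add.trans h)
    simp [onInterval, remaining, hj, h1]
  have hj' : j ≠ ∞ := (hj.trans_lt ENNReal.ofReal_lt_top).ne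
  have hjt : j.toReal ≤ t := by
    have h2 := ENNReal.toReal_mono ENNReal.ofReal_ne_top hj
    rwa [ENNReal.toReal_ofReal ht] at h2
  set r := t - j.toReal with hr
  have hr0 : 0 ≤ r := sub_nonneg.2 hjt
  have hrt : r ≤ t := by linarith [@ENNReal.toReal_nonneg j]
  have hrem : remaining w t (j, y) = w r y := if_pos hj
  rw [hrem, integral_prod _ hint]
  have hcdf : ∀ s, 0 < s → onInterval (w 0) t j (j + ENNReal.ofReal s / a) y =
      if j + ENNReal.ofReal s / a ≤ ENNReal.ofReal t then 0 else w 0 y := by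
    intro s _
    unfold onInterval
    by_cases h : j + ENNReal.ofReal s / a ≤ ENNReal.ofReal t
    · rw [if_pos h, if_neg fun h' => (not_lt.2 h) h'.2]
    · rw [if_neg h, if_pos ⟨hj, not_le.1 h⟩]
  rcases eq_or_ne a 0 with ha0 | ha0
  · -- absorbing state: the solution is constant in time
    have hconst : w r y = w 0 y := by
      have hd : ∀ s ∈ Icc 0 t, w' s y = 0 := fun s hs => by
        rw [hw.eq y hy s hs, ← ha, ha0]; simp
      have hc := constant_of_has_deriv_right_zero (f := fun s => w s y) (a := 0) (b := t)
        (fun s _ => (hw.hasDerivAt y s).continuousAt.continuousWithinAt) (fun s hs => by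
          have h := (hw.hasDerivAt y s).hasDerivWithinAt (s := Ici s)
          rwa [hd s ⟨hs.1, hs.2.le⟩] at h)
      exact hc r ⟨hr0, hrt⟩
    rw [hconst]
    have : ∀ᵐ s ∂expMeasure 1, ∫ z, (onInterval (w 0) t j (j + ENNReal.ofReal s / a) y +
        remaining w t (j + ENNReal.ofReal s / a, z)) ∂jumpKernel G y = w 0 y := by
      filter_upwards [ae_expMeasure_pos] with s hs
      have h1 : j + ENNReal.ofReal s / a = ∞ := by
        rw [ha0, ENNReal.div_zero (by simpa using hs), add_top]
      rw [hcdf s hs, h1]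
      simp [remaining]
    rw [integral_congr_ae this]
    simp
  · set l := a.toReal with hl
    have hl0 : 0 < l := ENNReal.toReal_pos ha0 (hfin y hy)
    have hal : a = ENNReal.ofReal l := (ENNReal.ofReal_toReal (hfin y hy)).symm
    have hcond : ∀ s, 0 < s → (j + ENNReal.ofReal s / a ≤ ENNReal.ofReal t ↔ s ≤ l * r) ∧
        t - (j + ENNReal.ofReal s / a).toReal = r - s / l := by
      intro s hs
      have hsl : 0 ≤ s / l := by positivity
      rw [hal, ← ENNReal.ofReal_div_of_pos hl0]
      obtain ⟨i, hi0, rfl⟩ : ∃ i : ℝ, 0 ≤ i ∧ j = ENNReal.ofReal i :=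
        ⟨j.toReal, ENNReal.toReal_nonneg, (ENNReal.ofReal_toReal hj').symm⟩
      rw [ENNReal.toReal_ofReal hi0] at hr
      rw [← ENNReal.ofReal_add hi0 hsl, ENNReal.ofReal_le_ofReal_iff ht,
        ENNReal.toReal_ofReal (by positivity)]
      refine ⟨?_, by rw [hr]; ring⟩
      rw [hr, ← div_le_iff₀' hl0]
      constructor <;> intro h <;> linarith
    rw [← integral_expMeasure_renewal (hw.hasDerivAt y) (hw.continuous y) hl0 hr0]
    refine integral_congr_ae ?_
    filter_upwards [ae_expMeasure_pos] with s hs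
    obtain ⟨h1, h2⟩ := hcond s hs
    rw [hcdf s hs]
    by_cases h : s ≤ l * r
    · have h3 := h1.2 h
      have hs' : r - s / l ∈ Icc 0 t := by
        have h4 : s / l ≤ r := (div_le_iff₀' hl0).2 h
        have h5 : 0 ≤ s / l := by positivity
        exact ⟨by linarith, by linarith⟩
      simp only [if_pos h3, if_pos h, remaining, zero_add, h2]
      rw [hw.eq y hy _ hs', ← ha, ← hl]
      field_simp
      ring
    · have h3 := fun h' => h (h1.1 h')
      simp only [if_neg h3, if_neg h, remaining, add_zero]
      simp

theorem measurable_onInterval_jumpTime (f : S → ℝ) (i : ℕ) :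
    Measurable fun ω : (ℕ → S) × (ℕ → ℝ) =>
      onInterval f t (jumpTime G ω i) (jumpTime G ω (i + 1)) (ω.1 i) :=
  (measurable_onInterval f t).comp (((measurable_jumpTime G i).prodMk
    (measurable_jumpTime G (i + 1))).prodMk (by fun_prop))

theorem measurable_observe (f : S → ℝ) : Measurable (observe G t f) := by
  refine measurable_of_tendsto_metrizable (f := fun (n : ℕ) (ω : (ℕ → S) × (ℕ → ℝ)) =>
    ∑ i ∈ Finset.range n, onInterval f t (jumpTime G ω i) (jumpTime G ω (i + 1)) (ω.1 i))
    (fun n => Finset.measurable_sum _ fun i _ => measurable_onInterval_jumpTime f i) ?_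
  rw [tendsto_pi_nhds]
  intro ω
  refine tendsto_const_nhds.congr' ?_
  simp only [sum_onInterval G f t]
  by_cases h : ∃ n, ¬ jumpTime G ω n ≤ ENNReal.ofReal t
  · obtain ⟨n, hn⟩ := h
    filter_upwards [eventually_ge_atTop n] with m hm
    rw [if_neg fun h' => hn ((jumpTime_mono G ω hm).trans h')]
  · push Not at h
    have h0 : observe G t f ω = 0 := by
      unfold observe stateAt
      rw [dif_neg]
      · rfl
      · rintro ⟨m, _, hm⟩
        exact (not_lt.2 (h (m + 1))) hm
    exact .of_forall fun n => by simp [h0]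

/-- A bounded solution of the backward equation of a nonexplosive chain is the expectation of its
initial data along the chain. -/
theorem SolvesBackward.expect_eq [Countable S] (hw : SolvesBackward G A t M w w')
    (hM : 0 ≤ M) (ht : 0 ≤ t)
    (hA : ∀ y ∈ A, ∀ᵐ z ∂jumpKernel G y, z ∈ A) (hfin : ∀ y ∈ A, exitRate G y ≠ ∞)
    {x : S} (hx : x ∈ A)
    (hexp : Tendsto (fun n => chainLaw G x {ω | jumpTime G ω n ≤ ENNReal.ofReal t}) atTop (𝓝 0)) :
    Integrable (observe G t (w 0)) (chainLaw G x) ∧ expect G x t (w 0) = w t x := by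
  set P := chainLaw G x with hP
  have hmem := ae_forall_mem hA hx
  have hobsM : ∀ᵐ ω ∂P, ‖observe G t (w 0) ω‖ ≤ M := by
    filter_upwards [hmem] with ω hω
    unfold observe stateAt
    split_ifs with h
    · exact hw.bound 0 ⟨le_rfl, ht⟩ _ (hω _)
    · simpa using hM
  have hobs : Integrable (observe G t (w 0)) P :=
    Integrable.of_bound (measurable_observe _).aestronglyMeasurable M hobsM
  refine ⟨hobs, ?_⟩
  have hQm : ∀ n, Measurable fun ω => remaining w t (jumpPoint G n ω) := fun n =>
    hw.measurable_remaining.comp (measurable_jumpPoint G n)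
  have hQb : ∀ n, ∀ᵐ ω ∂P, ‖remaining w t (jumpPoint G n ω)‖ ≤ M := fun n => by
    filter_upwards [hmem] with ω hω
    exact hw.abs_remaining_le hM ht _ (hω n)
  have hQi : ∀ n, Integrable (fun ω => remaining w t (jumpPoint G n ω)) P := fun n =>
    Integrable.of_bound (hQm n).aestronglyMeasurable M (hQb n)
  have hIi : ∀ n, Integrable (fun ω =>
      onInterval (w 0) t (jumpTime G ω n) (jumpTime G ω (n + 1)) (ω.1 n)) P := fun n => by
    refine Integrable.of_bound (measurable_onInterval_jumpTime _ n).aestronglyMeasurable M ?_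
    filter_upwards [hmem] with ω hω
    unfold onInterval
    split_ifs
    · exact hw.bound 0 ⟨le_rfl, ht⟩ _ (hω n)
    · simpa using hM
  have hstep : ∀ n, ∫ ω, remaining w t (jumpPoint G n ω) ∂P =
      ∫ ω, onInterval (w 0) t (jumpTime G ω n) (jumpTime G ω (n + 1)) (ω.1 n) ∂P +
        ∫ ω, remaining w t (jumpPoint G (n + 1) ω) ∂P := by
    intro n
    rw [← integral_add (hIi n) (hQi (n + 1))]
    have he : Measurable (exitRate G) := .of_discrete
    let F : (ℝ≥0∞ × S) × (ℝ × S) → ℝ := fun p =>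
      onInterval (w 0) t p.1.1 (p.1.1 + ENNReal.ofReal p.2.1 / exitRate G p.1.2) p.1.2 +
        remaining w t (p.1.1 + ENNReal.ofReal p.2.1 / exitRate G p.1.2, p.2.2)
    have hj : Measurable fun p : (ℝ≥0∞ × S) × (ℝ × S) =>
        p.1.1 + ENNReal.ofReal p.2.1 / exitRate G p.1.2 :=
      Measurable.add (by fun_prop) (Measurable.div (by fun_prop) (by fun_prop))
    have hF : Measurable F := by
      refine Measurable.add ?_ (hw.measurable_remaining.comp (hj.prodMk (by fun_prop)))
      exact (measurable_onInterval (w 0) t).comp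
        ((Measurable.prodMk (by fun_prop) hj).prodMk (by fun_prop))
    have hjp := measurable_jumpPoint G n
    have hpair : Measurable fun ω : (ℕ → S) × (ℕ → ℝ) =>
        (jumpPoint G n ω, (ω.2 n, ω.1 (n + 1))) := by fun_prop
    have h1 : ∫ ω, (onInterval (w 0) t (jumpTime G ω n) (jumpTime G ω (n + 1)) (ω.1 n) +
        remaining w t (jumpPoint G (n + 1) ω)) ∂P =
        ∫ p, F p ∂(P.map fun ω => (jumpPoint G n ω, (ω.2 n, ω.1 (n + 1)))) := by
      rw [integral_map hpair.aemeasurable hF.aestronglyMeasurable]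
      simp only [F, jumpPoint, jumpTime_succ]
    have h2 : Integrable F (P.map fun ω => (jumpPoint G n ω, (ω.2 n, ω.1 (n + 1)))) := by
      rw [integrable_map_measure hF.aestronglyMeasurable hpair.aemeasurable]
      refine ((hIi n).add (hQi (n + 1))).congr (.of_forall fun ω => ?_)
      simp [F, jumpPoint, jumpTime_succ]
    rw [h1]
    rw [map_jumpPoint_step] at h2 ⊢
    rw [Measure.integral_compProd h2, integral_map hjp.aemeasurable
      (hF.stronglyMeasurable.integral_kernel_prod_right').aestronglyMeasurable]
    refine integral_congr_ae ?_
    filter_upwards [hmem] with ω hω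
    rw [stepKernel_apply]
    exact (hw.integral_step hM ht hA hfin (jumpTime G ω n) (hω n)).2.symm
  have hsum : ∀ n, w t x = (∫ ω, ∑ i ∈ Finset.range n,
      onInterval (w 0) t (jumpTime G ω i) (jumpTime G ω (i + 1)) (ω.1 i) ∂P) +
        ∫ ω, remaining w t (jumpPoint G n ω) ∂P := by
    intro n
    induction n with
    | zero =>
      have h0 : ∀ᵐ ω ∂P, remaining w t (jumpPoint G 0 ω) = w t x := by
        filter_upwards [ae_fst_zero_eq G x] with ω hω
        simp [remaining, jumpPoint, hω]
      rw [integral_congr_ae h0]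
      simp
    | succ n ih =>
      rw [ih, hstep n]
      simp only [Finset.sum_range_succ]
      rw [integral_add (integrable_finsetSum _ fun i _ => hIi i) (hIi n)]
      ring
  set p : ℕ → ℝ := fun n => P.real {ω | jumpTime G ω n ≤ ENNReal.ofReal t} with hp
  have hms : ∀ n, MeasurableSet {ω | jumpTime G ω n ≤ ENNReal.ofReal t} := fun n =>
    measurableSet_le (measurable_jumpTime G n) measurable_const
  have hp0 : Tendsto (fun n => (M + M) * p n) atTop (𝓝 0) := by
    have h := (ENNReal.tendsto_toReal ENNReal.zero_ne_top).comp hexp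
    have h' := h.const_mul (M + M)
    rw [ENNReal.toReal_zero, mul_zero] at h'
    exact h'
  have hbound : ∀ n, |w t x - expect G x t (w 0)| ≤ (M + M) * p n := by
    intro n
    have hd : w t x - expect G x t (w 0) = ∫ ω, {ω | jumpTime G ω n ≤ ENNReal.ofReal t}.indicator
        (fun ω => remaining w t (jumpPoint G n ω) - observe G t (w 0) ω) ω ∂P := by
      have hi : Integrable (fun ω => (∑ i ∈ Finset.range n,
          onInterval (w 0) t (jumpTime G ω i) (jumpTime G ω (i + 1)) (ω.1 i)) +
            remaining w t (jumpPoint G n ω)) P :=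
        (integrable_finsetSum _ fun i _ => hIi i).add (hQi n)
      rw [hsum n, expect, ← hP, ← integral_add (integrable_finsetSum _ fun i _ => hIi i) (hQi n),
        ← integral_sub hi hobs]
      refine integral_congr_ae (.of_forall fun ω => ?_)
      dsimp only
      rw [sum_onInterval G (w 0) t]
      by_cases h : jumpTime G ω n ≤ ENNReal.ofReal t
      · rw [if_pos h, indicator_of_mem (by exact h), zero_add]
      · rw [if_neg h, indicator_of_notMem (by exact h)]
        simp [remaining, jumpPoint, h]
    rw [hd, integral_indicator (hms n)]
    rw [← Real.norm_eq_abs]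
    refine norm_setIntegral_le_of_norm_le_const_ae (measure_lt_top _ _) ?_
    filter_upwards [ae_restrict_of_ae (hQb n), ae_restrict_of_ae hobsM] with ω h1 h2
    exact (norm_sub_le _ _).trans (add_le_add h1 h2)
  have hle : |w t x - expect G x t (w 0)| ≤ 0 :=
    ge_of_tendsto' hp0 hbound
  linarith [abs_eq_zero.1 (le_antisymm hle (abs_nonneg _))]

end Backward

/-! ### Chains given by a list of moves -/

section Moves

open Classical in
/-- The generator `G` performs the move `x ↦ m x i` at rate `c x i`, for each index `i`. Only the
values of `G` on indicator functions of states matter for the law of the chain. -/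
structure HasMoves {S ι : Type*} (G : (S → ℝ) → S → ℝ) (c : S → ι → ℝ) (m : S → ι → S) : Prop where
  nonneg : ∀ x i, 0 ≤ c x i
  summable : ∀ x, Summable (c x)
  indicator : ∀ x y, x ≠ y → G (fun z => if z = y then 1 else 0) x =
    ∑' i, c x i * (if m x i = y then 1 else 0)

open Classical in
/-- The measure that gives the mass `c x i` to the target of each move that changes the state. -/
def moveMeasure {S ι : Type*} [MeasurableSpace S] (c : S → ι → ℝ) (m : S → ι → S) (x : S) :
    Measure S :=
  Measure.sum fun i => (if m x i = x then 0 else ENNReal.ofReal (c x i)) • Measure.dirac (m x i)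

variable {S ι : Type*} {G : (S → ℝ) → S → ℝ} {c : S → ι → ℝ} {m : S → ι → S}

open Classical in
theorem HasMoves.jumpRate_eq (h : HasMoves G c m) (x y : S) :
    jumpRate G x y = ∑' i, (if m x i = x then 0 else ENNReal.ofReal (c x i)) *
      (if m x i = y then 1 else 0) := by
  unfold jumpRate
  split_ifs with hxy
  · subst hxy
    symm
    refine ENNReal.tsum_eq_zero.2 fun i => ?_
    split_ifs <;> simp
  · rw [h.indicator x y hxy, ENNReal.ofReal_tsum_of_nonneg]
    · refine tsum_congr fun i => ?_
      by_cases hy : m x i = y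
      · have hx : m x i ≠ x := fun hx => hxy (hx.symm.trans hy)
        simp [hy, Ne.symm hxy]
      · simp [hy]
    · intro i
      exact mul_nonneg (h.nonneg x i) (by split_ifs <;> norm_num)
    · refine (h.summable x).of_nonneg_of_le (fun i => ?_) (fun i => ?_)
      · exact mul_nonneg (h.nonneg x i) (by split_ifs <;> norm_num)
      · exact mul_le_of_le_one_right (h.nonneg x i) (by split_ifs <;> norm_num)

variable [MeasurableSpace S] [DiscreteMeasurableSpace S] [Countable S]

theorem HasMoves.lintegral_moveMeasure (x : S) (F : S → ℝ≥0∞) :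
    ∫⁻ z, F z ∂moveMeasure c m x =
      ∑' i, (open Classical in if m x i = x then 0 else ENNReal.ofReal (c x i)) * F (m x i) := by
  rw [moveMeasure, lintegral_sum_measure]
  refine tsum_congr fun i => ?_
  rw [lintegral_smul_measure, lintegral_dirac, smul_eq_mul]

theorem HasMoves.exitRate_eq (h : HasMoves G c m) (x : S) :
    exitRate G x = moveMeasure c m x univ := by
  classical
  unfold exitRate
  simp only [h.jumpRate_eq]
  rw [ENNReal.tsum_comm, ← lintegral_one, HasMoves.lintegral_moveMeasure]
  refine tsum_congr fun i => ?_
  rw [ENNReal.tsum_mul_left, tsum_ite_eq' (m x i) (fun _ => (1 : ℝ≥0∞))]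

theorem HasMoves.exitRate_le (h : HasMoves G c m) (x : S) :
    exitRate G x ≤ ENNReal.ofReal (∑' i, c x i) := by
  classical
  rw [h.exitRate_eq, ← lintegral_one, HasMoves.lintegral_moveMeasure,
    ENNReal.ofReal_tsum_of_nonneg (h.nonneg x) (h.summable x)]
  refine ENNReal.tsum_le_tsum fun i => ?_
  split_ifs <;> simp

theorem HasMoves.exitRate_ne_top (h : HasMoves G c m) (x : S) : exitRate G x ≠ ∞ :=
  ((h.exitRate_le x).trans_lt ENNReal.ofReal_lt_top).ne

/-- The jump kernel is the normalised measure of moves. -/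
theorem HasMoves.smul_jumpKernel (h : HasMoves G c m) (x : S) :
    exitRate G x • jumpKernel G x = moveMeasure c m x := by
  classical
  have hfin := h.exitRate_ne_top x
  rcases eq_or_ne (exitRate G x) 0 with h0 | h0
  · rw [h0, zero_smul]
    rw [h.exitRate_eq] at h0
    exact (Measure.measure_univ_eq_zero.1 h0).symm
  refine Measure.ext_of_singleton fun y => ?_
  have h1 : jumpKernel G x {y} = jumpPMF G x y :=
    PMF.toMeasure_apply_singleton _ _ (.of_discrete)
  have h2 : jumpPMF G x y = jumpRate G x y * (exitRate G x)⁻¹ := by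
    have hh : (∑' y, jumpRate G x y) ≠ 0 ∧ (∑' y, jumpRate G x y) ≠ ∞ := ⟨h0, hfin⟩
    unfold jumpPMF
    rw [dif_pos hh, PMF.normalize_apply]
    rfl
  have h3 : moveMeasure c m x {y} = jumpRate G x y := by
    rw [h.jumpRate_eq, ← lintegral_indicator_one (.of_discrete),
      HasMoves.lintegral_moveMeasure]
    refine tsum_congr fun i => ?_
    simp only [indicator_apply, mem_singleton_iff, Pi.one_apply]
  rw [Measure.smul_apply, h1, h2, h3, smul_eq_mul, mul_left_comm,
    ENNReal.mul_inv_cancel h0 hfin, mul_one]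

theorem HasMoves.exitRate_mul_lintegral (h : HasMoves G c m) (x : S) (F : S → ℝ≥0∞) :
    exitRate G x * ∫⁻ z, F z ∂jumpKernel G x =
      ∑' i, (open Classical in if m x i = x then 0 else ENNReal.ofReal (c x i)) * F (m x i) := by
  rw [← HasMoves.lintegral_moveMeasure, ← h.smul_jumpKernel, lintegral_smul_measure, smul_eq_mul]

theorem HasMoves.ae_jumpKernel_mem (h : HasMoves G c m) {A : Set S}
    (hA : ∀ y ∈ A, ∀ i, m y i ∈ A) : ∀ y ∈ A, ∀ᵐ z ∂jumpKernel G y, z ∈ A := by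
  classical
  intro y hy
  rcases eq_or_ne (exitRate G y) 0 with h0 | h0
  · have h1 : jumpPMF G y = PMF.pure y := dif_neg fun h' => h'.1 h0
    have h2 : jumpKernel G y = Measure.dirac y := by
      change (jumpPMF G y).toMeasure = _
      rw [h1, PMF.toMeasure_pure]
    rw [h2, ae_dirac_iff .of_discrete]
    exact hy
  · have h1 : moveMeasure c m y Aᶜ = 0 := by
      rw [← lintegral_indicator_one (.of_discrete), HasMoves.lintegral_moveMeasure]
      refine ENNReal.tsum_eq_zero.2 fun i => ?_
      simp [hA y hy i]
    rw [← h.smul_jumpKernel, Measure.smul_apply, smul_eq_mul] at h1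
    exact (mul_eq_zero.1 h1).resolve_left h0

/-- The generator in terms of the embedded chain agrees with the sum over the moves. -/
theorem HasMoves.exitRate_mul_integral_sub [Countable ι] (h : HasMoves G c m) (x : S)
    (f : S → ℝ) {C : ℝ} (hf : ∀ i, |f (m x i)| ≤ C) :
    (exitRate G x).toReal * (∫ z, f z ∂jumpKernel G x - f x) =
      ∑' i, c x i * (f (m x i) - f x) := by
  classical
  have hfin := h.exitRate_ne_top x
  have hfinite : IsFiniteMeasure (moveMeasure c m x) :=
    ⟨by rw [← h.exitRate_eq]; exact hfin.lt_top⟩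
  have hg : Integrable (fun z => f z - f x) (moveMeasure c m x) := by
    refine Integrable.of_bound (Measurable.of_discrete.aestronglyMeasurable) (C + |f x|) ?_
    rw [moveMeasure, Measure.ae_sum_iff]
    intro i
    refine Measure.ae_smul_measure ?_ _
    rw [ae_dirac_iff .of_discrete]
    exact (norm_sub_le _ _).trans (add_le_add_left (hf i) _)
  have h1 : (exitRate G x).toReal * (∫ z, f z ∂jumpKernel G x - f x) =
      ∫ z, (f z - f x) ∂moveMeasure c m x := by
    rw [← h.smul_jumpKernel, integral_smul_measure, smul_eq_mul]
    rcases eq_or_ne (exitRate G x) 0 with h0 | h0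
    · simp [h0]
    congr 1
    have hi : Integrable (fun z => f z - f x) (jumpKernel G x) := by
      rw [← h.smul_jumpKernel] at hg
      exact (integrable_smul_measure h0 hfin).1 hg
    have hi' : Integrable f (jumpKernel G x) := by
      refine (hi.add (integrable_const (f x))).congr (.of_forall fun z => ?_)
      simp
    rw [integral_sub hi' (integrable_const _)]
    simp
  rw [h1]
  have h2 := hasSum_integral_measure (f := fun z => f z - f x)
    (μ := fun i => (if m x i = x then 0 else ENNReal.ofReal (c x i)) • Measure.dirac (m x i)) hg
  rw [moveMeasure, ← h2.tsum_eq]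
  refine tsum_congr fun i => ?_
  rw [integral_smul_measure, integral_dirac, smul_eq_mul]
  split_ifs with hi
  · simp [hi]
  · rw [ENNReal.toReal_ofReal (h.nonneg x i)]

end Moves

/-! ### The moves of the exclusion process -/

namespace ExclConfig

theorem loc_add_of_packed {x : ExclConfig} {N : ℕ}
    (hN : ∀ n, N ≤ n → x.loc n - x.loc (n + 1) = 1) (n : ℕ) : x.loc (N + n) = x.loc N - n := by
  induction n with
  | zero => simp
  | succ n ih =>
    have := hN (N + n) (by omega)
    rw [← add_assoc]
    push_cast
    omega

/-- A configuration is determined by finitely many locations. -/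
instance : Countable ExclConfig := by
  choose N hN using fun x : ExclConfig => x.packed
  refine Function.Injective.countable
    (f := fun x : ExclConfig => (List.range (N x + 1)).map x.loc) fun x x' h => ?_
  have hlen := congrArg List.length h
  simp only [List.length_map, List.length_range, Nat.add_right_cancel_iff] at hlen
  dsimp only at h
  rw [← hlen, List.map_inj_left] at h
  refine ExclConfig.ext (funext fun n => ?_)
  rcases le_or_gt n (N x) with hn | hn
  · exact h n (List.mem_range.2 (by omega))
  · obtain ⟨k, rfl⟩ := Nat.exists_eq_add_of_lt hn
    have h1 := loc_add_of_packed (hN x) (k + 1)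
    have h2 := loc_add_of_packed (hN x') (k + 1)
    rw [← hlen] at h2
    rw [add_assoc, h1, h2, h (N x) (List.mem_range.2 (by omega))]

/-- The configuration is eventually packed with `loc n = c - n`. The constant `c` is a conserved
quantity of the exclusion process. -/
def HasTail (c : ℤ) (x : ExclConfig) : Prop := ∃ N, ∀ n, N ≤ n → x.loc n + n = c

theorem exists_hasTail (x : ExclConfig) : ∃ c, x.HasTail c := by
  obtain ⟨N, hN⟩ := x.packed
  refine ⟨x.loc N + N, N, fun n hn => ?_⟩
  obtain ⟨k, rfl⟩ := Nat.exists_eq_add_of_le hn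
  rw [loc_add_of_packed hN]
  push_cast
  ring

theorem loc_add_antitone (x : ExclConfig) : Antitone fun n : ℕ => x.loc n + n :=
  antitone_nat_of_succ_le fun n => by
    have := x.strictAnti n
    push_cast
    omega

theorem HasTail.le {c : ℤ} {x : ExclConfig} (h : x.HasTail c) (n : ℕ) : c ≤ x.loc n + n := by
  obtain ⟨N, hN⟩ := h
  rw [← hN (max N n) (le_max_left _ _)]
  exact x.loc_add_antitone (le_max_right N n)

theorem moveOf_loc_cases (x : ExclConfig) (n : ℕ) (d : ℤ) :
    (x.moveOf n d).loc = Function.update x.loc n (x.loc n + d) ∨ x.moveOf n d = x := by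
  unfold moveOf
  split_ifs with h
  · exact Or.inl rfl
  · exact Or.inr rfl

theorem HasTail.moveOf {c : ℤ} {x : ExclConfig} (h : x.HasTail c) (n : ℕ) (d : ℤ) :
    (x.moveOf n d).HasTail c := by
  rcases x.moveOf_loc_cases n d with h1 | h1
  · obtain ⟨N, hN⟩ := h
    refine ⟨max N (n + 1), fun k hk => ?_⟩
    rw [h1, Function.update_of_ne (by omega)]
    exact hN k (by omega)
  · rwa [h1]

theorem gap_cast (x : ExclConfig) (n : ℕ) : (x.gap n : ℤ) = x.loc n - x.loc (n + 1) - 1 := by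
  have := x.strictAnti n
  unfold gap
  omega

theorem sum_gap (x : ExclConfig) (N : ℕ) :
    ((∑ n ∈ Finset.range N, x.gap n : ℕ) : ℤ) = x.loc 0 - (x.loc N + N) := by
  induction N with
  | zero => simp
  | succ N ih =>
    rw [Finset.sum_range_succ, Nat.cast_add, ih, gap_cast]
    push_cast
    ring

/-- The gaps vanish from some index on. -/
theorem exists_gap_eq_zero (x : ExclConfig) : ∃ N, ∀ n, N ≤ n → x.gap n = 0 := by
  obtain ⟨N, hN⟩ := x.packed
  exact ⟨N, fun n hn => by have := hN n hn; unfold gap; omega⟩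

/-- The total number of empty sites to the left of the first particle, in a configuration with
tail constant `c`. -/
def holes (c : ℤ) (x : ExclConfig) : ℕ := (x.loc 0 - c).toNat

theorem HasTail.sum_gap_le {c : ℤ} {x : ExclConfig} (h : x.HasTail c) (N : ℕ) :
    ∑ n ∈ Finset.range N, x.gap n ≤ x.holes c := by
  have h1 := x.sum_gap N
  have h2 := h.le N
  unfold holes
  omega

theorem HasTail.gap_le {c : ℤ} {x : ExclConfig} (h : x.HasTail c) (n : ℕ) :
    x.gap n ≤ x.holes c :=
  (Finset.single_le_sum (f := x.gap) (fun _ _ => Nat.zero_le _)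
    (Finset.self_mem_range_succ n)).trans
    (h.sum_gap_le (n + 1))

theorem holes_moveOf_le (c : ℤ) (x : ExclConfig) (n : ℕ) (d : ℤ) :
    (x.moveOf n d).holes c ≤ x.holes c + if n = 0 then d.toNat else 0 := by
  rcases x.moveOf_loc_cases n d with h1 | h1
  · unfold holes
    rw [h1]
    split_ifs with hn
    · subst hn
      rw [Function.update_self]
      omega
    · rw [Function.update_of_ne (Ne.symm hn)]
      omega
  · rw [h1]; omega

end ExclConfig

/-- The labels of the moves of the exclusion process: `inl (n, j)` and `inr (n, j)` displace the
particle `loc n` by `j + 1` sites to the right and to the left. -/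
abbrev AEPMove : Type := (ℕ × ℕ) ⊕ (ℕ × ℕ)

/-- The rate of a move of the exclusion process. -/
def aepRate (q ν R L : ℝ) (x : ExclConfig) : AEPMove → ℝ
  | .inl (0, j) => phiRInf q ν R (j + 1)
  | .inl (n + 1, j) => if j < x.gap n then phiR q ν R (j + 1) (x.gap n) else 0
  | .inr (n, j) => if j < x.gap n then phiL q ν L (j + 1) (x.gap n) else 0

/-- The configuration after a move of the exclusion process. -/
def aepMove (x : ExclConfig) : AEPMove → ExclConfig
  | .inl (n, j) => x.moveOf n ((j + 1 : ℕ) : ℤ)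
  | .inr (n, j) => x.moveOf n (-((j + 1 : ℕ) : ℤ))

section AEP

variable {q ν R L : ℝ}

theorem phiRInf_nonneg (hq0 : 0 < q) (hν0 : 0 ≤ ν) (hR : 0 ≤ R) (j : ℕ) :
    0 ≤ phiRInf q ν R (j + 1) :=
  mul_nonneg hR (div_nonneg (pow_nonneg hν0 _) (qInt_pos hq0 (by omega)).le)

theorem phiR_nonneg (hq0 : 0 < q) (hq1 : q < 1) (hν0 : 0 ≤ ν) (hν1 : ν < 1) (hR : 0 ≤ R)
    (j m : ℕ) : 0 ≤ phiR q ν R (j + 1) m := by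
  rw [phiR_eq]
  have h1 := qBinCoeff_pos hq0 hq1 hν1 m
  have h2 := qBinCoeff_pos hq0 hq1 hν1 (m - (j + 1))
  have h3 := qInt_pos hq0 (Nat.le_add_left 1 j)
  positivity

theorem phiL_nonneg (hq0 : 0 < q) (hq1 : q < 1) (hν1 : ν < 1) (hL : 0 ≤ L)
    (j m : ℕ) : 0 ≤ phiL q ν L (j + 1) m := by
  rw [phiL_eq]
  have h1 := qBinCoeff_pos hq0 hq1 hν1 m
  have h2 := qBinCoeff_pos hq0 hq1 hν1 (m - (j + 1))
  have h3 := qInt_pos hq0 (Nat.le_add_left 1 j)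
  positivity

theorem aepRate_nonneg (hq0 : 0 < q) (hq1 : q < 1) (hν0 : 0 ≤ ν) (hν1 : ν < 1) (hR : 0 ≤ R)
    (hL : 0 ≤ L) (x : ExclConfig) (i : AEPMove) : 0 ≤ aepRate q ν R L x i := by
  rcases i with ⟨_ | n, j⟩ | ⟨n, j⟩
  · exact phiRInf_nonneg hq0 hν0 hR j
  · dsimp only [aepRate]
    split_ifs
    exacts [phiR_nonneg hq0 hq1 hν0 hν1 hR j _, le_rfl]
  · dsimp only [aepRate]
    split_ifs
    exacts [phiL_nonneg hq0 hq1 hν1 hL j _, le_rfl]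

theorem hasSum_ite_lt (f : ℕ → ℝ) (m : ℕ) :
    HasSum (fun j => if j < m then f j else 0) (∑ j ∈ Finset.range m, f j) := by
  have h : ∑ j ∈ Finset.range m, f j = ∑ j ∈ Finset.range m, if j < m then f j else 0 :=
    Finset.sum_congr rfl fun j hj => (if_pos (Finset.mem_range.1 hj)).symm
  rw [h]
  exact hasSum_sum_of_ne_finset_zero fun j hj => if_neg fun h' => hj (Finset.mem_range.2 h')

/-- The sum over the right moves of one particle. -/
def rightMoveSum (q ν R : ℝ) (x : ExclConfig) (g : AEPMove → ℝ) : ℕ → ℝ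
  | 0 => ∑' j, phiRInf q ν R (j + 1) * g (.inl (0, j))
  | n + 1 => ∑ j ∈ Finset.range (x.gap n), phiR q ν R (j + 1) (x.gap n) * g (.inl (n + 1, j))

/-- The sum over the left moves of one particle. -/
def leftMoveSum (q ν L : ℝ) (x : ExclConfig) (g : AEPMove → ℝ) (n : ℕ) : ℝ :=
  ∑ j ∈ Finset.range (x.gap n), phiL q ν L (j + 1) (x.gap n) * g (.inr (n, j))

theorem tsum_aepRate_inl (x : ExclConfig) (g : AEPMove → ℝ) (n : ℕ) :
    ∑' j, aepRate q ν R L x (.inl (n, j)) * g (.inl (n, j)) = rightMoveSum q ν R x g n := by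
  cases n with
  | zero => rfl
  | succ n =>
    simp only [aepRate, ite_mul, zero_mul]
    exact (hasSum_ite_lt _ _).tsum_eq

theorem tsum_aepRate_inr (x : ExclConfig) (g : AEPMove → ℝ) (n : ℕ) :
    ∑' j, aepRate q ν R L x (.inr (n, j)) * g (.inr (n, j)) = leftMoveSum q ν L x g n := by
  simp only [aepRate, ite_mul, zero_mul]
  exact (hasSum_ite_lt _ _).tsum_eq

theorem summable_moveSum (q ν R L : ℝ) (x : ExclConfig) (g : AEPMove → ℝ) :
    Summable (rightMoveSum q ν R x g) ∧ Summable (leftMoveSum q ν L x g) := by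
  obtain ⟨N, hN⟩ := x.exists_gap_eq_zero
  constructor
  · refine summable_of_ne_finset_zero (s := Finset.range (N + 1)) fun n hn => ?_
    cases n with
    | zero => simp at hn
    | succ n => simp [rightMoveSum, hN n (by simpa using hn)]
  · refine summable_of_ne_finset_zero (s := Finset.range N) fun n hn => ?_
    simp [leftMoveSum, hN n (by simpa using hn)]

theorem summable_aepRate (hq0 : 0 < q) (hq1 : q < 1) (hν0 : 0 ≤ ν) (hν1 : ν < 1) (hR : 0 ≤ R)
    (hL : 0 ≤ L) (x : ExclConfig) : Summable (aepRate q ν R L x) := by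
  have h0 := aepRate_nonneg hq0 hq1 hν0 hν1 hR hL x
  have hg := summable_moveSum q ν R L x 1
  refine Summable.sum _ ?_ ?_
  · refine (summable_prod_of_nonneg fun p => h0 _).2 ⟨fun n => ?_, ?_⟩
    · cases n with
      | zero => exact summable_phiRInf hq0 hν0 hν1 R
      | succ n => exact (hasSum_ite_lt _ _).summable
    · refine hg.1.congr fun n => ?_
      rw [← tsum_aepRate_inl (L := L)]
      simp
  · refine (summable_prod_of_nonneg fun p => h0 _).2 ⟨fun n => ?_, ?_⟩
    · exact (hasSum_ite_lt _ _).summable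
    · refine hg.2.congr fun n => ?_
      rw [← tsum_aepRate_inr (R := R)]
      simp

theorem tsum_aepRate_mul (hq0 : 0 < q) (hq1 : q < 1) (hν0 : 0 ≤ ν) (hν1 : ν < 1) (hR : 0 ≤ R)
    (hL : 0 ≤ L) (x : ExclConfig) {g : AEPMove → ℝ} {C : ℝ} (hg : ∀ i, |g i| ≤ C) :
    ∑' i, aepRate q ν R L x i * g i =
      ∑' n, (rightMoveSum q ν R x g n + leftMoveSum q ν L x g n) := by
  have hs : Summable fun i => aepRate q ν R L x i * g i := by
    refine Summable.of_norm_bounded ((summable_aepRate hq0 hq1 hν0 hν1 hR hL x).mul_right C)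
      fun i => ?_
    rw [norm_mul, Real.norm_of_nonneg (aepRate_nonneg hq0 hq1 hν0 hν1 hR hL x i)]
    exact mul_le_mul_of_nonneg_left (hg i) (aepRate_nonneg hq0 hq1 hν0 hν1 hR hL x i)
  have h1 : Summable ((fun i => aepRate q ν R L x i * g i) ∘ Sum.inl) :=
    hs.comp_injective Sum.inl_injective
  have h2 : Summable ((fun i => aepRate q ν R L x i * g i) ∘ Sum.inr) :=
    hs.comp_injective Sum.inr_injective
  have hm := summable_moveSum q ν R L x g
  rw [(HasSum.sum h1.hasSum h2.hasSum).tsum_eq, hm.1.tsum_add hm.2, h1.tsum_prod, h2.tsum_prod]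
  congr 1
  · exact tsum_congr fun n => tsum_aepRate_inl x g n
  · exact tsum_congr fun n => tsum_aepRate_inr x g n

theorem genAEP_eq_tsum (hq0 : 0 < q) (hq1 : q < 1) (hν0 : 0 ≤ ν) (hν1 : ν < 1) (hR : 0 ≤ R)
    (hL : 0 ≤ L) (x : ExclConfig) {f : ExclConfig → ℝ} {C : ℝ} (hf : ∀ i, |f (aepMove x i)| ≤ C) :
    genAEP q ν R L f x = ∑' i, aepRate q ν R L x i * (f (aepMove x i) - f x) := by
  rw [tsum_aepRate_mul hq0 hq1 hν0 hν1 hR hL x (C := C + |f x|) fun i =>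
    (abs_sub _ _).trans (add_le_add_left (hf i) _)]
  refine tsum_congr fun n => ?_
  congr 1
  · cases n with
    | zero => rfl
    | succ n => exact sum_Icc_one_eq_sum_range _ _
  · exact sum_Icc_one_eq_sum_range _ _

theorem hasMoves_genAEP (hq0 : 0 < q) (hq1 : q < 1) (hν0 : 0 ≤ ν) (hν1 : ν < 1) (hR : 0 ≤ R)
    (hL : 0 ≤ L) : HasMoves (genAEP q ν R L) (aepRate q ν R L) aepMove where
  nonneg := aepRate_nonneg hq0 hq1 hν0 hν1 hR hL
  summable := summable_aepRate hq0 hq1 hν0 hν1 hR hL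
  indicator x y hxy := by
    rw [genAEP_eq_tsum hq0 hq1 hν0 hν1 hR hL x (C := 1) fun i => by split_ifs <;> simp]
    simp [hxy]

/-- The total rate `∑_j (φ^R(j|m) + φ^L(j|m))` grows at most linearly for `m ≤ N`. -/
theorem exists_siteRate_le (hq0 : 0 < q) (hq1 : q < 1) (hν0 : 0 ≤ ν) (hν1 : ν < 1) (hR : 0 ≤ R)
    (hL : 0 ≤ L) (N : ℕ) : ∃ K : ℝ, 0 ≤ K ∧ ∀ m ≤ N, ∑ j ∈ Finset.range m, phiR q ν R (j + 1) m +
      ∑ j ∈ Finset.range m, phiL q ν L (j + 1) m ≤ K * m := by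
  let φ : ℕ → ℝ := fun m => ∑ j ∈ Finset.range m, phiR q ν R (j + 1) m +
    ∑ j ∈ Finset.range m, phiL q ν L (j + 1) m
  have hφ0 : ∀ m, 0 ≤ φ m := fun m => add_nonneg
    (Finset.sum_nonneg fun j _ => phiR_nonneg hq0 hq1 hν0 hν1 hR j m)
    (Finset.sum_nonneg fun j _ => phiL_nonneg hq0 hq1 hν1 hL j m)
  refine ⟨∑ m ∈ Finset.range (N + 1), φ m, Finset.sum_nonneg fun m _ => hφ0 m, fun m hm => ?_⟩
  rcases Nat.eq_zero_or_pos m with rfl | hpos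
  · simp
  · have h1 : φ m ≤ ∑ m ∈ Finset.range (N + 1), φ m :=
      Finset.single_le_sum (f := φ) (fun i _ => hφ0 i) (Finset.mem_range.2 (by omega))
    have h2 : (1 : ℝ) ≤ m := by exact_mod_cast hpos
    exact h1.trans (le_mul_of_one_le_right ((hφ0 m).trans h1) h2)

/-- The total rate of the moves is bounded in terms of the number of holes. -/
theorem exists_tsum_aepRate_le (hq0 : 0 < q) (hq1 : q < 1) (hν0 : 0 ≤ ν) (hν1 : ν < 1)
    (hR : 0 ≤ R) (hL : 0 ≤ L) (N : ℕ) : ∃ Λ : ℝ, ∀ (c : ℤ) (x : ExclConfig), x.HasTail c →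
      x.holes c ≤ N → ∑' i, aepRate q ν R L x i ≤ Λ := by
  obtain ⟨K, hK0, hK⟩ := exists_siteRate_le hq0 hq1 hν0 hν1 hR hL N
  refine ⟨∑' j, phiRInf q ν R (j + 1) + K * N, fun c x hx hN => ?_⟩
  have h1 := tsum_aepRate_mul hq0 hq1 hν0 hν1 hR hL x (g := fun _ => 1) (C := 1) (by simp)
  have hm := summable_moveSum q ν R L x (fun _ => 1)
  have hm1 : Summable fun n => rightMoveSum q ν R x (fun _ => 1) (n + 1) :=
    (summable_nat_add_iff 1).2 hm.1
  simp only [mul_one] at h1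
  rw [h1, hm.1.tsum_add hm.2, hm.1.tsum_eq_zero_add, add_assoc, ← hm1.tsum_add hm.2]
  refine add_le_add (by simp [rightMoveSum]) ?_
  have h2 : ∀ n, rightMoveSum q ν R x (fun _ => 1) (n + 1) +
      leftMoveSum q ν L x (fun _ => 1) n ≤ K * x.gap n := by
    intro n
    simpa [rightMoveSum, leftMoveSum] using hK _ ((hx.gap_le n).trans hN)
  obtain ⟨N₀, hN₀⟩ := x.exists_gap_eq_zero
  rw [tsum_eq_sum (s := Finset.range N₀) fun n hn => by
    simp [rightMoveSum, leftMoveSum, hN₀ n (by simpa using hn)]]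
  calc _ ≤ ∑ n ∈ Finset.range N₀, K * x.gap n := Finset.sum_le_sum fun n _ => h2 n
    _ = K * ((∑ n ∈ Finset.range N₀, x.gap n : ℕ) : ℝ) := by push_cast; rw [Finset.mul_sum]
    _ ≤ K * N := by
        refine mul_le_mul_of_nonneg_left ?_ hK0
        exact_mod_cast (hx.sum_gap_le N₀).trans hN

/-- The Lyapunov function of the exclusion process. -/
def aepLyapunov (c : ℤ) (x : ExclConfig) : ℝ≥0∞ := 1 + x.holes c

theorem summable_phiRInf_mul (hq0 : 0 < q) (hν0 : 0 ≤ ν) (hν1 : ν < 1) (hR : 0 ≤ R) :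
    Summable fun j : ℕ => phiRInf q ν R (j + 1) * (j + 1 : ℕ) := by
  have h1 := summable_pow_mul_geometric_of_norm_lt_one 1
    (show ‖ν‖ < 1 by rwa [Real.norm_of_nonneg hν0])
  have h2 := (h1.add (summable_geometric_of_lt_one hν0 hν1)).mul_left R
  refine h2.of_nonneg_of_le (fun j => mul_nonneg (phiRInf_nonneg hq0 hν0 hR j) (by positivity))
    fun j => ?_
  have h3 : (1 : ℝ) ≤ qInt q (j + 1) := by
    rw [qInt, Finset.sum_range_succ']
    simp only [pow_zero, le_add_iff_nonneg_left]
    exact Finset.sum_nonneg fun i _ => by positivity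
  have h4 : ν ^ j / qInt q (j + 1) ≤ ν ^ j := div_le_self (pow_nonneg hν0 _) h3
  rw [phiRInf, Nat.add_sub_cancel, mul_assoc]
  refine mul_le_mul_of_nonneg_left ?_ hR
  push_cast
  calc ν ^ j / qInt q (j + 1) * ((j : ℝ) + 1) ≤ ν ^ j * ((j : ℝ) + 1) :=
        mul_le_mul_of_nonneg_right h4 (by positivity)
    _ = _ := by ring

/-- Only the right jumps of the first particle increase the number of holes, by a bounded expected
amount per unit of time. -/
theorem exists_aepLyapunov_drift (hq0 : 0 < q) (hq1 : q < 1) (hν0 : 0 ≤ ν) (hν1 : ν < 1)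
    (hR : 0 ≤ R) (hL : 0 ≤ L) : ∃ θ : ℝ, 0 < θ ∧ ∀ (c : ℤ) (x : ExclConfig),
      exitRate (genAEP q ν R L) x * ∫⁻ z, aepLyapunov c z ∂jumpKernel (genAEP q ν R L) x ≤
        (exitRate (genAEP q ν R L) x + ENNReal.ofReal θ) * aepLyapunov c x := by
  classical
  have hnn : ∀ j : ℕ, 0 ≤ phiRInf q ν R (j + 1) * (j + 1 : ℕ) := fun j =>
    mul_nonneg (phiRInf_nonneg hq0 hν0 hR j) (by positivity)
  -- the summand `1` only makes the constant positive, also when `R = 0`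
  refine ⟨1 + ∑' j : ℕ, phiRInf q ν R (j + 1) * (j + 1 : ℕ),
    add_pos_of_pos_of_nonneg one_pos (tsum_nonneg hnn), fun c x => ?_⟩
  have h := hasMoves_genAEP hq0 hq1 hν0 hν1 hR hL
  set θ := 1 + ∑' j : ℕ, phiRInf q ν R (j + 1) * (j + 1 : ℕ) with hθ
  let d : AEPMove → ℝ≥0∞ := fun i => match i with
    | .inl (0, j) => ENNReal.ofReal (phiRInf q ν R (j + 1)) * (j + 1 : ℕ)
    | _ => 0
  have hd : ∑' i, d i ≤ ENNReal.ofReal θ := by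
    have hinj : Function.Injective fun j : ℕ => (Sum.inl (0, j) : AEPMove) := fun a b hab => by
      simpa using hab
    have hsupp : Function.support d ⊆ range fun j : ℕ => (Sum.inl (0, j) : AEPMove) := by
      rintro (⟨_ | n, j⟩ | ⟨n, j⟩) hi
      · exact ⟨j, rfl⟩
      · exact absurd rfl hi
      · exact absurd rfl hi
    rw [← hinj.tsum_eq hsupp]
    have h1 : ∀ j : ℕ, d (.inl (0, j)) = ENNReal.ofReal (phiRInf q ν R (j + 1) * (j + 1 : ℕ)) := by
      intro j
      rw [ENNReal.ofReal_mul (phiRInf_nonneg hq0 hν0 hR j), ENNReal.ofReal_natCast]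
      rfl
    simp only [h1]
    rw [← ENNReal.ofReal_tsum_of_nonneg hnn (summable_phiRInf_mul hq0 hν0 hν1 hR)]
    exact ENNReal.ofReal_le_ofReal (by rw [hθ]; linarith)
  have hV1 : 1 ≤ aepLyapunov c x := le_self_add
  have hstep : ∀ i, (if aepMove x i = x then 0 else ENNReal.ofReal (aepRate q ν R L x i)) *
      aepLyapunov c (aepMove x i) ≤
      (if aepMove x i = x then 0 else ENNReal.ofReal (aepRate q ν R L x i)) * aepLyapunov c x +
        d i := by
    intro i
    split_ifs with hi
    · simp
    have hV : ∀ (n : ℕ) (e : ℤ), aepLyapunov c (x.moveOf n e) ≤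
        aepLyapunov c x + (if n = 0 then e.toNat else 0 : ℕ) := by
      intro n e
      have := ExclConfig.holes_moveOf_le c x n e
      unfold aepLyapunov
      rw [add_assoc]
      gcongr
      exact_mod_cast this
    rcases i with ⟨_ | n, j⟩ | ⟨n, j⟩
    · refine (mul_le_mul' le_rfl (hV 0 _)).trans ?_
      rw [mul_add, if_pos rfl]
      exact le_of_eq rfl
    · refine (mul_le_mul' le_rfl (hV (n + 1) _)).trans ?_
      simp
    · refine (mul_le_mul' le_rfl (hV n _)).trans ?_
      have : (if n = 0 then (-((j + 1 : ℕ) : ℤ)).toNat else 0) = 0 := by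
        split_ifs
        · omega
        · rfl
      rw [this]
      simp
  calc _ = ∑' i, (if aepMove x i = x then 0 else ENNReal.ofReal (aepRate q ν R L x i)) *
        aepLyapunov c (aepMove x i) := h.exitRate_mul_lintegral x _
    _ ≤ ∑' i, ((if aepMove x i = x then 0 else ENNReal.ofReal (aepRate q ν R L x i)) *
        aepLyapunov c x + d i) := ENNReal.tsum_le_tsum hstep
    _ = exitRate (genAEP q ν R L) x * aepLyapunov c x + ∑' i, d i := by
        rw [ENNReal.tsum_add, ENNReal.tsum_mul_right]
        have h1 := h.exitRate_mul_lintegral x 1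
        simp only [Pi.one_apply, lintegral_one, measure_univ, mul_one] at h1
        rw [h1]
    _ ≤ _ := by
        rw [add_mul]
        gcongr
        exact hd.trans (le_mul_of_one_le_right zero_le hV1)

/-- The exclusion process does not explode. -/
theorem tendsto_measure_jumpTime_genAEP (hq0 : 0 < q) (hq1 : q < 1) (hν0 : 0 ≤ ν) (hν1 : ν < 1)
    (hR : 0 ≤ R) (hL : 0 ≤ L) {c : ℤ} {x : ExclConfig} (hx : x.HasTail c) {t : ℝ} (ht : 0 ≤ t) :
    Tendsto (fun n => chainLaw (genAEP q ν R L) x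
      {ω | jumpTime (genAEP q ν R L) ω n ≤ ENNReal.ofReal t}) atTop (𝓝 0) := by
  have h := hasMoves_genAEP hq0 hq1 hν0 hν1 hR hL
  obtain ⟨θ, hθ, hdrift⟩ := exists_aepLyapunov_drift hq0 hq1 hν0 hν1 hR hL
  refine tendsto_measure_jumpTime_le (A := {x | x.HasTail c}) (V := aepLyapunov c) (θ := θ)
    (h.ae_jumpKernel_mem ?_) hθ (fun y _ => h.exitRate_ne_top y) ?_ (fun y _ => hdrift c y) ?_ hx ht
  · rintro y hy (⟨n, j⟩ | ⟨n, j⟩)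
    · exact ExclConfig.HasTail.moveOf hy n _
    · exact ExclConfig.HasTail.moveOf hy n _
  · intro y _
    simp [aepLyapunov]
  · intro M hM
    obtain ⟨Λ, hΛ⟩ := exists_tsum_aepRate_le hq0 hq1 hν0 hν1 hR hL ⌊M.toReal⌋₊
    refine ⟨ENNReal.ofReal Λ, ENNReal.ofReal_ne_top, fun y hy hV => ?_⟩
    refine (h.exitRate_le y).trans (ENNReal.ofReal_le_ofReal (hΛ c y hy (Nat.le_floor ?_)))
    have h1 : ((y.holes c : ℕ) : ℝ≥0∞) ≤ M := le_add_self.trans hV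
    simpa using ENNReal.toReal_mono hM h1

end AEP

/-! ### Duality of the generators -/

section Duality

variable {q ν R L : ℝ}

theorem weight_succ_pos (hq0 : 0 < q) (x : ExclConfig) (n : ℕ) : 0 < weight q x (n + 1) :=
  zpow_pos hq0 _

theorem weight_succ_div_weight (hq0 : 0 < q) (x : ExclConfig) (n : ℕ) :
    weight q x (n + 1) / weight q x (n + 2) = q ^ x.gap n := by
  simp only [weight]
  rw [← zpow_sub₀ hq0.ne', ← zpow_natCast, x.gap_cast]
  congr 1
  push_cast
  ring

theorem dualH_of_loc_eq_update (hq0 : 0 < q) {x x' : ExclConfig} {n : ℕ} {d : ℤ}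
    (h : x'.loc = Function.update x.loc n (x.loc n + d)) (y : ℕ →₀ ℕ) :
    dualH q x' y = dualH q x y * (q ^ d) ^ y (n + 1) := by
  have hw : ∀ i, weight q x' i = weight q x i * if i = n + 1 then q ^ d else 1 := by
    intro i
    cases i with
    | zero => simp [weight]
    | succ i =>
      simp only [weight, h]
      rcases eq_or_ne i n with rfl | hi
      · rw [Function.update_self, if_pos rfl, ← zpow_add₀ hq0.ne']
        congr 1
        ring
      · rw [Function.update_of_ne hi, if_neg (by omega), mul_one]
  unfold dualH Finsupp.prod
  simp only [hw, mul_pow, Finset.prod_mul_distrib]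
  congr 1
  simp only [ite_pow, one_pow]
  rw [Finset.prod_ite_eq']
  split_ifs with hn
  · rfl
  · rw [Finsupp.notMem_support_iff.1 hn, pow_zero]

theorem dualH_add (q : ℝ) (x : ExclConfig) (y z : ℕ →₀ ℕ) :
    dualH q x (y + z) = dualH q x y * dualH q x z :=
  Finsupp.prod_add_index' (fun _ => pow_zero _) fun _ _ _ => pow_add _ _ _

theorem dualH_single (q : ℝ) (x : ExclConfig) (i j : ℕ) :
    dualH q x (Finsupp.single i j) = weight q x i ^ j :=
  Finsupp.prod_single_index (pow_zero _)

theorem dualH_transfer {q : ℝ} {x : ExclConfig} {y : ℕ →₀ ℕ} {i j : ℕ} (hw : weight q x i ≠ 0)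
    (hj : j ≤ y i) (i' : ℕ) : dualH q x (y - Finsupp.single i j + Finsupp.single i' j) =
      dualH q x y * (weight q x i' / weight q x i) ^ j := by
  have h1 : y - Finsupp.single i j + Finsupp.single i j = y :=
    tsub_add_cancel_of_le (Finsupp.single_le_iff.2 hj)
  have h2 := dualH_add q x (y - Finsupp.single i j) (Finsupp.single i j)
  rw [h1, dualH_single] at h2
  rw [dualH_add, dualH_single, h2, div_pow]
  have := pow_ne_zero j hw
  field_simp

theorem genRight_dualH (hq0 : 0 < q) (hq1 : q < 1) (hν0 : 0 ≤ ν) (hν1 : ν < 1) (x : ExclConfig)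
    (y : ℕ →₀ ℕ) (n : ℕ) : genRight q ν R (fun x' => dualH q x' y) x n =
      ∑ j ∈ Finset.Icc 1 (y (n + 1)), phiR q ν R j (y (n + 1)) *
        (dualH q x (y - Finsupp.single (n + 1) j + Finsupp.single n j) - dualH q x y) := by
  have hw := (weight_succ_pos hq0 x n).ne'
  cases n with
  | zero =>
    have h1 := (hasSum_phiRInf hq0 hq1 hν0 hν1 R (y 1)).mul_left (dualH q x y)
    have h2 : ∀ j : ℕ, phiRInf q ν R (j + 1) *
        (dualH q (x.moveOf 0 ((j + 1 : ℕ) : ℤ)) y - dualH q x y) =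
        dualH q x y * (phiRInf q ν R (j + 1) * (q ^ ((j + 1) * y 1) - 1)) := by
      intro j
      rw [dualH_of_loc_eq_update hq0 (x.moveOf_loc_right_zero (j + 1)) y, zpow_natCast, ← pow_mul]
      ring
    simp only [genRight, h2]
    rw [h1.tsum_eq, ← Finset.sum_neg_distrib, Finset.mul_sum]
    refine Finset.sum_congr rfl fun j hj => ?_
    obtain ⟨hj1, hj2⟩ := Finset.mem_Icc.1 hj
    -- the particles that move to the site `0` make the functional vanish
    have h3 : weight q x 0 = 0 := rfl
    rw [dualH_transfer hw hj2, h3, zero_div, zero_pow (by omega)]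
    ring
  | succ n =>
    have h1 := congrArg (dualH q x y * ·) (sum_phiR_comm hq0 hq1 hν1 R (x.gap n) (y (n + 2)))
    simp only [Finset.mul_sum] at h1
    simp only [genRight]
    refine Eq.trans (Finset.sum_congr rfl fun j hj => ?_)
      (h1.trans (Finset.sum_congr rfl fun j hj => ?_))
    · rw [dualH_of_loc_eq_update hq0 (x.moveOf_loc_right n j (Finset.mem_Icc.1 hj).2) y,
        zpow_natCast, ← pow_mul]
      ring
    · rw [dualH_transfer hw (Finset.mem_Icc.1 hj).2, weight_succ_div_weight hq0, ← pow_mul,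
        mul_comm j]
      ring

theorem genLeft_dualH (hq0 : 0 < q) (hq1 : q < 1) (hν1 : ν < 1) (x : ExclConfig)
    (y : ℕ →₀ ℕ) (n : ℕ) : genLeft q ν L (fun x' => dualH q x' y) x n =
      ∑ j ∈ Finset.Icc 1 (y (n + 1)), phiL q ν L j (y (n + 1)) *
        (dualH q x (y - Finsupp.single (n + 1) j + Finsupp.single (n + 1 + 1) j) -
          dualH q x y) := by
  have hw := (weight_succ_pos hq0 x n).ne'
  have h1 := congrArg (dualH q x y * ·) (sum_phiL_comm hq0 hq1 hν1 L (x.gap n) (y (n + 1)))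
  simp only [Finset.mul_sum] at h1
  refine Eq.trans (Finset.sum_congr rfl fun j hj => ?_)
    (h1.trans (Finset.sum_congr rfl fun j hj => ?_))
  · dsimp only
    rw [dualH_of_loc_eq_update hq0 (x.moveOf_loc_left n j (Finset.mem_Icc.1 hj).2) y, zpow_neg,
      zpow_natCast, inv_pow, ← pow_mul]
    ring
  · rw [dualH_transfer hw (Finset.mem_Icc.1 hj).2, ← inv_div, weight_succ_div_weight hq0, inv_pow,
      ← pow_mul, mul_comm j]
    ring

theorem genAZRP_eq_tsum (f : (ℕ →₀ ℕ) → ℝ) (y : ℕ →₀ ℕ) : genAZRP q ν R L f y =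
    ∑' n, (∑ j ∈ Finset.Icc 1 (y (n + 1)), phiR q ν R j (y (n + 1)) *
        (f (y - Finsupp.single (n + 1) j + Finsupp.single n j) - f y) +
      ∑ j ∈ Finset.Icc 1 (y (n + 1)), phiL q ν L j (y (n + 1)) *
        (f (y - Finsupp.single (n + 1) j + Finsupp.single (n + 1 + 1) j) - f y)) := by
  set b : ℕ → ℝ := fun i => if i = 0 then 0 else
    ∑ j ∈ Finset.Icc 1 (y i), phiR q ν R j (y i) *
        (f (y - Finsupp.single i j + Finsupp.single (i - 1) j) - f y) +
      ∑ j ∈ Finset.Icc 1 (y i), phiL q ν L j (y i) *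
        (f (y - Finsupp.single i j + Finsupp.single (i + 1) j) - f y) with hb
  have hz : ∀ i ∉ y.support.erase 0, b i = 0 := by
    intro i hi
    by_cases h0 : i = 0
    · simp [hb, h0]
    · have : y i = 0 := by
        by_contra h
        exact hi (Finset.mem_erase.2 ⟨h0, Finsupp.mem_support_iff.2 h⟩)
      simp [hb, this]
  have h1 : genAZRP q ν R L f y = ∑' i, b i := by
    rw [tsum_eq_sum hz]
    refine Finset.sum_congr rfl fun i hi => ?_
    rw [hb]
    dsimp only
    rw [if_neg (Finset.ne_of_mem_erase hi)]
  rw [h1, (summable_of_ne_finset_zero hz).tsum_eq_zero_add]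
  simp [hb]

/-- Duality at the level of generators: the generator of the exclusion process acting on the first
variable of the duality functional agrees with that of the zero-range process acting on the
second. -/
theorem genAEP_dualH (hq0 : 0 < q) (hq1 : q < 1) (hν0 : 0 ≤ ν) (hν1 : ν < 1) (x : ExclConfig)
    (y : ℕ →₀ ℕ) :
    genAEP q ν R L (fun x' => dualH q x' y) x = genAZRP q ν R L (dualH q x) y := by
  rw [genAZRP_eq_tsum]
  refine tsum_congr fun n => ?_
  rw [genRight_dualH hq0 hq1 hν0 hν1, genLeft_dualH hq0 hq1 hν1]

end Duality

/-! ### The moves of the zero-range process -/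

namespace Weyl

variable {k : ℕ}

instance : Countable (Weyl k) :=
  Function.Injective.countable (f := Weyl.pos) fun _ _ h => Weyl.ext h

theorem sum_occ (n : Weyl k) : (n.occ.sum fun _ => id) = k := by
  unfold occ
  rw [← Finsupp.sum_finsetSum_index (fun _ => rfl) (fun _ _ _ => rfl)]
  simp

/-- Every sequence of occupation numbers of total mass `k` comes from a vector in `W^k`. -/
theorem exists_occ_eq {y : ℕ →₀ ℕ} (hy : (y.sum fun _ => id) = k) : ∃ n : Weyl k, n.occ = y := by
  set l := (Finsupp.toMultiset y).sort (· ≥ ·) with hl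
  have hlen : l.length = k := by rw [hl, Multiset.length_sort, Finsupp.card_toMultiset, hy]
  have hsort : l.Pairwise (· ≥ ·) := Multiset.pairwise_sort _ _
  clear_value l
  subst hlen
  refine ⟨⟨l.get, hsort.sortedGE.antitone_get⟩, ?_⟩
  apply Multiset.toFinsupp.symm.injective
  change Finsupp.toMultiset _ = Finsupp.toMultiset _
  unfold occ
  rw [map_sum]
  simp only [Finsupp.toMultiset_single, one_smul]
  have h1 : ∑ a, ({l.get a} : Multiset ℕ) = (List.ofFn l.get : Multiset ℕ) := by
    rw [← Fin.univ_val_map, ← Multiset.sum_map_singleton (Finset.univ.val.map l.get),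
      Multiset.map_map]
    rfl
  rw [h1, List.ofFn_get, hl, Multiset.sort_eq]

theorem sum_occ_le (n : Weyl k) (s : Finset ℕ) : ∑ i ∈ s, n.occ i ≤ k := by
  calc ∑ i ∈ s, n.occ i ≤ ∑ i ∈ s ∪ n.occ.support, n.occ i :=
        Finset.sum_le_sum_of_subset Finset.subset_union_left
    _ = ∑ i ∈ n.occ.support, n.occ i := by
        refine (Finset.sum_subset Finset.subset_union_right fun i _ hi => ?_).symm
        exact Finsupp.notMem_support_iff.1 hi
    _ = k := n.sum_occ

theorem occ_le (n : Weyl k) (i : ℕ) : n.occ i ≤ k := by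
  simpa using n.sum_occ_le {i}

/-- The occupation numbers after `j` particles have moved from `i` to `i'`. -/
theorem exists_occ_eq_transfer (n : Weyl k) {i j : ℕ} (hj : j ≤ n.occ i) (i' : ℕ) :
    ∃ n' : Weyl k, n'.occ = n.occ - Finsupp.single i j + Finsupp.single i' j := by
  refine exists_occ_eq ?_
  have h1 : n.occ - Finsupp.single i j + Finsupp.single i j = n.occ :=
    tsub_add_cancel_of_le (Finsupp.single_le_iff.2 hj)
  have h2 : ∀ a b : ℕ →₀ ℕ, ((a + b).sum fun _ => id) = (a.sum fun _ => id) + b.sum fun _ => id :=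
    fun a b => Finsupp.sum_add_index' (fun _ => rfl) fun _ _ _ => rfl
  have h3 := n.sum_occ
  rw [← h1, h2, Finsupp.sum_single_index rfl] at h3
  rw [h2, Finsupp.sum_single_index rfl]
  exact h3

open Classical in
/-- The vector with the given occupation numbers (and `n` if there is none). -/
def ofOcc (n : Weyl k) (y : ℕ →₀ ℕ) : Weyl k :=
  if h : ∃ n' : Weyl k, n'.occ = y then h.choose else n

theorem extend_occ_apply (h : Weyl k → ℝ) (n : Weyl k) {y : ℕ →₀ ℕ}
    (hy : ∃ n' : Weyl k, n'.occ = y) : Function.extend occ h 0 y = h (ofOcc n y) := by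
  have h1 : (ofOcc n y).occ = y := by
    unfold ofOcc
    rw [dif_pos hy]
    exact hy.choose_spec
  conv_lhs => rw [← h1]
  exact occ_injective.extend_apply _ _ _

end Weyl

section AZRP

variable {q ν R L : ℝ} {k : ℕ}

/-- The labels of the moves of the zero-range process: `inl (i, j)` and `inr (i, j)` move `j + 1`
particles from the site `i` to `i - 1` and to `i + 1`. -/
abbrev AZRPMove : Type := (ℕ × ℕ) ⊕ (ℕ × ℕ)

/-- The rate of a move of the zero-range process. -/
def azrpRate (q ν R L : ℝ) (n : Weyl k) : AZRPMove → ℝ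
  | .inl p => if p.1 ∈ n.occ.support.erase 0 ∧ p.2 < n.occ p.1 then
      phiR q ν R (p.2 + 1) (n.occ p.1) else 0
  | .inr p => if p.1 ∈ n.occ.support.erase 0 ∧ p.2 < n.occ p.1 then
      phiL q ν L (p.2 + 1) (n.occ p.1) else 0

/-- The positions after a move of the zero-range process. -/
def azrpMove (n : Weyl k) : AZRPMove → Weyl k
  | .inl p => n.ofOcc (n.occ - Finsupp.single p.1 (p.2 + 1) + Finsupp.single (p.1 - 1) (p.2 + 1))
  | .inr p => n.ofOcc (n.occ - Finsupp.single p.1 (p.2 + 1) + Finsupp.single (p.1 + 1) (p.2 + 1))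

theorem azrpRate_nonneg (hq0 : 0 < q) (hq1 : q < 1) (hν0 : 0 ≤ ν) (hν1 : ν < 1) (hR : 0 ≤ R)
    (hL : 0 ≤ L) (n : Weyl k) (i : AZRPMove) : 0 ≤ azrpRate q ν R L n i := by
  rcases i with p | p <;> dsimp only [azrpRate] <;> split_ifs
  exacts [phiR_nonneg hq0 hq1 hν0 hν1 hR _ _, le_rfl, phiL_nonneg hq0 hq1 hν1 hL _ _, le_rfl]

theorem hasSum_ite_mem_and_lt (s : Finset ℕ) (y : ℕ → ℕ) (f : ℕ × ℕ → ℝ) :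
    HasSum (fun p : ℕ × ℕ => if p.1 ∈ s ∧ p.2 < y p.1 then f p else 0)
      (∑ i ∈ s, ∑ j ∈ Finset.range (y i), f (i, j)) := by
  have h : ∑ i ∈ s, ∑ j ∈ Finset.range (y i), f (i, j) =
      ∑ p ∈ (s.sigma fun i => Finset.range (y i)).map (Equiv.sigmaEquivProd ℕ ℕ).toEmbedding,
        if p.1 ∈ s ∧ p.2 < y p.1 then f p else 0 := by
    rw [Finset.sum_map, Finset.sum_sigma']
    refine Finset.sum_congr rfl fun p hp => ?_
    rw [Finset.mem_sigma, Finset.mem_range] at hp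
    exact (if_pos hp).symm
  rw [h]
  refine hasSum_sum_of_ne_finset_zero fun p hp => if_neg fun h' => hp ?_
  rw [Finset.mem_map]
  exact ⟨⟨p.1, p.2⟩, Finset.mem_sigma.2 ⟨h'.1, Finset.mem_range.2 h'.2⟩, rfl⟩

theorem hasSum_azrpRate_mul (n : Weyl k) (g : AZRPMove → ℝ) :
    HasSum (fun i => azrpRate q ν R L n i * g i) (∑ i ∈ n.occ.support.erase 0,
      (∑ j ∈ Finset.range (n.occ i), phiR q ν R (j + 1) (n.occ i) * g (.inl (i, j)) +
        ∑ j ∈ Finset.range (n.occ i), phiL q ν L (j + 1) (n.occ i) * g (.inr (i, j)))) := by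
  rw [Finset.sum_add_distrib]
  refine HasSum.sum ?_ ?_
  · refine (hasSum_ite_mem_and_lt (n.occ.support.erase 0) n.occ
      (fun p => phiR q ν R (p.2 + 1) (n.occ p.1) * g (.inl p))).congr_fun fun p => ?_
    simp only [Function.comp_apply, azrpRate, ite_mul, zero_mul]
  · refine (hasSum_ite_mem_and_lt (n.occ.support.erase 0) n.occ
      (fun p => phiL q ν L (p.2 + 1) (n.occ p.1) * g (.inr p))).congr_fun fun p => ?_
    simp only [Function.comp_apply, azrpRate, ite_mul, zero_mul]

theorem summable_azrpRate (n : Weyl k) : Summable (azrpRate q ν R L n) := by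
  simpa using (hasSum_azrpRate_mul (q := q) (ν := ν) (R := R) (L := L) n 1).summable

theorem hasSum_genWeyl (h : Weyl k → ℝ) (n : Weyl k) :
    HasSum (fun i => azrpRate q ν R L n i * (h (azrpMove n i) - h n)) (genWeyl q ν R L h n) := by
  have h1 := hasSum_azrpRate_mul (q := q) (ν := ν) (R := R) (L := L) n
    (fun i => h (azrpMove n i) - h n)
  convert h1 using 1
  unfold genWeyl genAZRP
  refine Finset.sum_congr rfl fun i _ => ?_
  rw [sum_Icc_one_eq_sum_range, sum_Icc_one_eq_sum_range, Weyl.occ_injective.extend_apply]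
  congr 1 <;> refine Finset.sum_congr rfl fun j hj => ?_ <;>
    rw [Weyl.extend_occ_apply h n (n.exists_occ_eq_transfer (Finset.mem_range.1 hj) _)] <;> rfl

theorem hasMoves_genWeyl (hq0 : 0 < q) (hq1 : q < 1) (hν0 : 0 ≤ ν) (hν1 : ν < 1) (hR : 0 ≤ R)
    (hL : 0 ≤ L) : HasMoves (genWeyl q ν R L (k := k)) (azrpRate q ν R L) azrpMove where
  nonneg := azrpRate_nonneg hq0 hq1 hν0 hν1 hR hL
  summable := summable_azrpRate
  indicator n n' hn := by
    rw [← (hasSum_genWeyl _ n).tsum_eq]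
    simp [hn]

/-- The exit rates of the zero-range process with `k` particles are bounded. -/
theorem exists_tsum_azrpRate_le (hq0 : 0 < q) (hq1 : q < 1) (hν0 : 0 ≤ ν) (hν1 : ν < 1)
    (hR : 0 ≤ R) (hL : 0 ≤ L) (k : ℕ) :
    ∃ Λ : ℝ, 0 ≤ Λ ∧ ∀ n : Weyl k, ∑' i, azrpRate q ν R L n i ≤ Λ := by
  obtain ⟨K, hK0, hK⟩ := exists_siteRate_le hq0 hq1 hν0 hν1 hR hL k
  refine ⟨K * k, by positivity, fun n => ?_⟩
  have h1 := (hasSum_azrpRate_mul (q := q) (ν := ν) (R := R) (L := L) n 1).tsum_eq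
  simp only [Pi.one_apply, mul_one] at h1
  rw [h1]
  calc _ ≤ ∑ i ∈ n.occ.support.erase 0, K * n.occ i :=
        Finset.sum_le_sum fun i _ => hK _ (n.occ_le i)
    _ = K * ((∑ i ∈ n.occ.support.erase 0, n.occ i : ℕ) : ℝ) := by
        push_cast; rw [Finset.mul_sum]
    _ ≤ K * k := mul_le_mul_of_nonneg_left (by exact_mod_cast n.sum_occ_le _) hK0

/-- The zero-range process does not explode. -/
theorem tendsto_measure_jumpTime_genWeyl (hq0 : 0 < q) (hq1 : q < 1) (hν0 : 0 ≤ ν) (hν1 : ν < 1)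
    (hR : 0 ≤ R) (hL : 0 ≤ L) (n : Weyl k) {t : ℝ} (ht : 0 ≤ t) :
    Tendsto (fun m => chainLaw (genWeyl q ν R L) n
      {ω | jumpTime (genWeyl q ν R L) ω m ≤ ENNReal.ofReal t}) atTop (𝓝 0) := by
  have h := hasMoves_genWeyl (k := k) hq0 hq1 hν0 hν1 hR hL
  obtain ⟨Λ, _, hΛ⟩ := exists_tsum_azrpRate_le hq0 hq1 hν0 hν1 hR hL k
  refine tendsto_measure_jumpTime_le (A := univ) (V := fun _ => 1) (θ := 1)
    (fun _ _ => .of_forall fun _ => mem_univ _) one_pos (fun y _ => h.exitRate_ne_top y)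
    (by simp) (fun y _ => by simp) (fun M _ => ⟨ENNReal.ofReal Λ, ENNReal.ofReal_ne_top,
      fun y _ _ => (h.exitRate_le y).trans (ENNReal.ofReal_le_ofReal (hΛ y))⟩) (mem_univ n) ht

/-- The duality of the generators, for the zero-range process on `W^k`. -/
theorem genWeyl_dualH (hq0 : 0 < q) (hq1 : q < 1) (hν0 : 0 ≤ ν) (hν1 : ν < 1) (x : ExclConfig)
    (n : Weyl k) : genWeyl q ν R L (fun n' : Weyl k => dualH q x n'.occ) n =
      genAEP q ν R L (fun x' => dualH q x' n.occ) x := by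
  rw [genAEP_dualH hq0 hq1 hν0 hν1]
  have hext : ∀ n' : Weyl k, Function.extend Weyl.occ (fun n' : Weyl k => dualH q x n'.occ) 0
      n'.occ = dualH q x n'.occ := fun n' => Weyl.occ_injective.extend_apply _ _ _
  unfold genWeyl genAZRP
  refine Finset.sum_congr rfl fun i _ => ?_
  congr 1 <;> refine Finset.sum_congr rfl fun j hj => ?_
  · obtain ⟨n', hn'⟩ := n.exists_occ_eq_transfer (Finset.mem_Icc.1 hj).2 (i - 1)
    rw [← hn', hext, hext]
  · obtain ⟨n', hn'⟩ := n.exists_occ_eq_transfer (Finset.mem_Icc.1 hj).2 (i + 1)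
    rw [← hn', hext, hext]

/-- The duality functional is bounded on the configurations with a given tail constant. -/
theorem abs_dualH_le (hq0 : 0 < q) (hq1 : q < 1) {c : ℤ} {x : ExclConfig} (hx : x.HasTail c)
    (n : Weyl k) : |dualH q x n.occ| ≤ max 1 (q ^ (c + 1)) ^ k := by
  have hw : ∀ i, |weight q x i| ≤ max 1 (q ^ (c + 1)) := by
    intro i
    cases i with
    | zero => simp [weight]
    | succ i =>
      rw [abs_of_pos (weight_succ_pos hq0 x i)]
      refine le_max_of_le_right (zpow_le_zpow_right_of_le_one₀ hq0 hq1.le ?_)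
      have := hx.le i
      omega
  have h1 : (max 1 (q ^ (c + 1))) ^ k = n.occ.prod fun _ m => (max 1 (q ^ (c + 1))) ^ m := by
    unfold Finsupp.prod
    rw [Finset.prod_pow_eq_pow_sum]
    congr 1
    exact n.sum_occ.symm
  rw [h1, dualH, Finsupp.prod, Finsupp.prod, Finset.abs_prod]
  refine Finset.prod_le_prod (fun i _ => abs_nonneg _) fun i _ => ?_
  rw [abs_pow]
  exact pow_le_pow_left₀ (abs_nonneg _) (hw i) _

end AZRP

/-! ### Semigroups of bounded operators -/

section BoundedGenerator

variable {E : Type*} [NormedAddCommGroup E] [NormedSpace ℝ E]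

/-- The semigroup `exp (s B)` generated by a bounded operator `B`. -/
def semigroup (B : E →L[ℝ] E) (s : ℝ) : E →L[ℝ] E := NormedSpace.exp (s • B)

theorem semigroup_zero_apply (B : E →L[ℝ] E) (v : E) : semigroup B 0 v = v := by
  simp [semigroup]

theorem semigroup_apply_comm (B : E →L[ℝ] E) (v : E) (s : ℝ) :
    semigroup B s (B v) = B (semigroup B s v) := by
  have h : Commute (NormedSpace.exp (s • B)) B := ((Commute.refl B).smul_left s).exp_left
  exact congrArg (fun A : E →L[ℝ] E => A v) h.eq

variable [CompleteSpace E]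

theorem hasDerivAt_semigroup (B : E →L[ℝ] E) (s : ℝ) :
    HasDerivAt (semigroup B) (semigroup B s * B) s :=
  hasDerivAt_exp_smul_const (𝕂 := ℝ) B s

theorem hasDerivAt_semigroup_apply (φ : E →L[ℝ] ℝ) (B : E →L[ℝ] E) (v : E) (s : ℝ) :
    HasDerivAt (fun s : ℝ => φ (semigroup B s v)) (φ (semigroup B s (B v))) s :=
  (φ.comp (ContinuousLinearMap.apply ℝ E v)).hasFDerivAt.comp_hasDerivAt s
    (hasDerivAt_semigroup B s)

theorem exists_norm_semigroup_le (B : E →L[ℝ] E) (t : ℝ) :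
    ∃ K : ℝ, 0 ≤ K ∧ ∀ s ∈ Icc 0 t, ∀ v : E, ‖semigroup B s v‖ ≤ K * ‖v‖ := by
  have hc : Continuous (semigroup B) :=
    continuous_iff_continuousAt.2 fun s => (hasDerivAt_semigroup B s).continuousAt
  obtain ⟨K, hK⟩ := (isCompact_Icc (a := (0 : ℝ)) (b := t)).exists_bound_of_continuousOn
    hc.continuousOn
  refine ⟨max K 0, le_max_right _ _, fun s hs v => ?_⟩
  exact ((semigroup B s).le_opNorm v).trans
    (mul_le_mul_of_nonneg_right ((hK s hs).trans (le_max_left _ _)) (norm_nonneg v))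

end BoundedGenerator

/-! ### The semigroup of the zero-range process and duality -/

section Semigroup

open scoped BoundedContinuousFunction

variable {q ν R L : ℝ} {k : ℕ}

/-- `W^k` carries the discrete topology, so that `Weyl k →ᵇ ℝ` is the space of all bounded
functions. -/
instance : TopologicalSpace (Weyl k) := ⊥

instance : DiscreteTopology (Weyl k) := ⟨rfl⟩

/-- The generator of the zero-range process is a bounded operator on bounded functions. -/
theorem exists_clm_genWeyl (hq0 : 0 < q) (hq1 : q < 1) (hν0 : 0 ≤ ν) (hν1 : ν < 1) (hR : 0 ≤ R)
    (hL : 0 ≤ L) (k : ℕ) : ∃ B : (Weyl k →ᵇ ℝ) →L[ℝ] (Weyl k →ᵇ ℝ),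
      ∀ h n, B h n = genWeyl q ν R L h n := by
  obtain ⟨Λ, hΛ0, hΛ⟩ := exists_tsum_azrpRate_le hq0 hq1 hν0 hν1 hR hL k
  have hnn := azrpRate_nonneg (k := k) hq0 hq1 hν0 hν1 hR hL
  have hb : ∀ (h : Weyl k →ᵇ ℝ) (n : Weyl k), ‖genWeyl q ν R L h n‖ ≤ Λ * 2 * ‖h‖ := by
    intro h n
    have h1 : ∀ i, ‖azrpRate q ν R L n i * (h (azrpMove n i) - h n)‖ ≤
        azrpRate q ν R L n i * (2 * ‖h‖) := fun i => by
      rw [norm_mul, Real.norm_of_nonneg (hnn n i)]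
      refine mul_le_mul_of_nonneg_left ?_ (hnn n i)
      rw [← dist_eq_norm]
      exact h.dist_le_two_norm _ _
    have h2 : Summable fun i => azrpRate q ν R L n i * (2 * ‖h‖) :=
      (summable_azrpRate n).mul_right _
    rw [← (hasSum_genWeyl h n).tsum_eq]
    calc _ ≤ ∑' i, azrpRate q ν R L n i * (2 * ‖h‖) := tsum_of_norm_bounded h2.hasSum h1
      _ = (∑' i, azrpRate q ν R L n i) * (2 * ‖h‖) := tsum_mul_right
      _ ≤ Λ * (2 * ‖h‖) := mul_le_mul_of_nonneg_right (hΛ n) (by positivity)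
      _ = _ := by ring
  let B₀ : (Weyl k →ᵇ ℝ) →ₗ[ℝ] (Weyl k →ᵇ ℝ) :=
    { toFun := fun h => BoundedContinuousFunction.ofNormedAddCommGroupDiscrete
        (genWeyl q ν R L h) (Λ * 2 * ‖h‖) (hb h)
      map_add' := fun f g => by
        ext n
        refine (hasSum_genWeyl _ n).unique ?_
        refine ((hasSum_genWeyl f n).add (hasSum_genWeyl g n)).congr_fun fun i => ?_
        simp only [BoundedContinuousFunction.coe_add, Pi.add_apply]
        ring
      map_smul' := fun a f => by
        ext n
        refine (hasSum_genWeyl _ n).unique ?_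
        refine ((hasSum_genWeyl f n).mul_left a).congr_fun fun i => ?_
        simp only [BoundedContinuousFunction.coe_smul, smul_eq_mul]
        ring }
  refine ⟨B₀.mkContinuous (Λ * 2) fun h => ?_, fun h n => rfl⟩
  exact BoundedContinuousFunction.norm_ofNormedAddCommGroup_le _ (by positivity) (hb h)

/-- The functions `H(x, ·)` as bounded functions on `W^k`. -/
theorem exists_bcf_dualH (hq0 : 0 < q) (hq1 : q < 1) (k : ℕ) :
    ∃ h : ExclConfig → (Weyl k →ᵇ ℝ), (∀ x n, h x n = dualH q x n.occ) ∧
      ∀ c x, ExclConfig.HasTail c x → ‖h x‖ ≤ max 1 (q ^ (c + 1)) ^ k := by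
  choose c hc using ExclConfig.exists_hasTail
  refine ⟨fun x => BoundedContinuousFunction.ofNormedAddCommGroupDiscrete
    (fun n : Weyl k => dualH q x n.occ) _ (abs_dualH_le hq0 hq1 (hc x)), fun x n => rfl,
    fun c x hx => ?_⟩
  exact (BoundedContinuousFunction.norm_le (by positivity)).2 (abs_dualH_le hq0 hq1 hx)

theorem hasDerivAt_semigroup_coe (B : (Weyl k →ᵇ ℝ) →L[ℝ] (Weyl k →ᵇ ℝ)) (v : Weyl k →ᵇ ℝ)
    (n : Weyl k) (s : ℝ) :
    HasDerivAt (fun s : ℝ => semigroup B s v n) (semigroup B s (B v) n) s :=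
  hasDerivAt_semigroup_apply (BoundedContinuousFunction.evalCLM ℝ n) B v s

theorem exists_abs_semigroup_le (B : (Weyl k →ᵇ ℝ) →L[ℝ] (Weyl k →ᵇ ℝ)) (t : ℝ) :
    ∃ K : ℝ, 0 ≤ K ∧ ∀ s ∈ Icc 0 t, ∀ (v : Weyl k →ᵇ ℝ) (n : Weyl k),
      |semigroup B s v n| ≤ K * ‖v‖ := by
  obtain ⟨K, hK0, hK⟩ := exists_norm_semigroup_le B t
  exact ⟨K, hK0, fun s hs v n =>
    (BoundedContinuousFunction.norm_coe_le_norm _ n).trans (hK s hs v)⟩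

/-- The zero-range semigroup applied to a bounded function is its expectation along the zero-range
process. -/
theorem expect_genWeyl (hq0 : 0 < q) (hq1 : q < 1) (hν0 : 0 ≤ ν) (hν1 : ν < 1) (hR : 0 ≤ R)
    (hL : 0 ≤ L) {B : (Weyl k →ᵇ ℝ) →L[ℝ] (Weyl k →ᵇ ℝ)}
    (hB : ∀ h n, B h n = genWeyl q ν R L h n) (v : Weyl k →ᵇ ℝ) (n : Weyl k) {t : ℝ}
    (ht : 0 ≤ t) : Integrable (observe (genWeyl q ν R L) t v) (chainLaw (genWeyl q ν R L) n) ∧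
      expect (genWeyl q ν R L) n t v = semigroup B t v n := by
  obtain ⟨K, hK0, hK⟩ := exists_abs_semigroup_le B t
  have h := hasMoves_genWeyl (k := k) hq0 hq1 hν0 hν1 hR hL
  have hw : SolvesBackward (genWeyl q ν R L) univ t (K * ‖v‖)
      (fun s n => semigroup B s v n) (fun s n => semigroup B s (B v) n) :=
    { bound := fun s hs n _ => hK s hs v n
      hasDerivAt := fun n s => hasDerivAt_semigroup_coe B v n s
      continuous := fun n => continuous_iff_continuousAt.2 fun s =>
        (hasDerivAt_semigroup_coe B (B v) n s).continuousAt
      eq := fun n _ s hs => by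
        rw [h.exitRate_mul_integral_sub n (fun n => semigroup B s v n) fun i =>
          hK s hs v _, (hasSum_genWeyl _ n).tsum_eq, semigroup_apply_comm, hB] }
  have h0 : (fun n => semigroup B 0 v n) = (v : Weyl k → ℝ) := by
    funext n; rw [semigroup_zero_apply]
  have := hw.expect_eq (by positivity) ht (fun _ _ => .of_forall fun _ => mem_univ _)
    (fun n _ => h.exitRate_ne_top n) (mem_univ n)
    (tendsto_measure_jumpTime_genWeyl hq0 hq1 hν0 hν1 hR hL n ht)
  simpa only [h0] using this

/-- The zero-range semigroup applied to `H(x, ·)` is the expectation of `H` along the exclusion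
process: by duality of the generators it solves the backward equation in `x`. -/
theorem expect_genAEP (hq0 : 0 < q) (hq1 : q < 1) (hν0 : 0 ≤ ν) (hν1 : ν < 1) (hR : 0 ≤ R)
    (hL : 0 ≤ L) {B : (Weyl k →ᵇ ℝ) →L[ℝ] (Weyl k →ᵇ ℝ)}
    (hB : ∀ h n, B h n = genWeyl q ν R L h n) {h : ExclConfig → (Weyl k →ᵇ ℝ)}
    (hh : ∀ x n, h x n = dualH q x n.occ)
    (hhb : ∀ c x, ExclConfig.HasTail c x → ‖h x‖ ≤ max 1 (q ^ (c + 1)) ^ k)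
    (x : ExclConfig) (n : Weyl k) {t : ℝ} (ht : 0 ≤ t) :
    Integrable (observe (genAEP q ν R L) t fun x' => dualH q x' n.occ)
        (chainLaw (genAEP q ν R L) x) ∧
      expect (genAEP q ν R L) x t (fun x' => dualH q x' n.occ) =
        semigroup B t (h x) n := by
  obtain ⟨K, hK0, hK⟩ := exists_abs_semigroup_le B t
  obtain ⟨c, hx⟩ := x.exists_hasTail
  set M : ℝ := max 1 (q ^ (c + 1)) ^ k with hM
  have hM0 : 0 ≤ M := by positivity
  have hmoves := hasMoves_genAEP hq0 hq1 hν0 hν1 hR hL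
  have hclosed : ∀ y ∈ {y | ExclConfig.HasTail c y}, ∀ i, aepMove y i ∈
      {y | ExclConfig.HasTail c y} := by
    rintro y hy (⟨n, j⟩ | ⟨n, j⟩)
    · exact ExclConfig.HasTail.moveOf hy n _
    · exact ExclConfig.HasTail.moveOf hy n _
  have hbound : ∀ s ∈ Icc 0 t, ∀ y, ExclConfig.HasTail c y →
      |semigroup B s (h y) n| ≤ K * M := fun s hs y hy =>
    (hK s hs (h y) n).trans (mul_le_mul_of_nonneg_left (hhb c y hy) hK0)
  -- the generator identity, as an absolutely convergent series of bounded functions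
  have hsum : ∀ y, ExclConfig.HasTail c y →
      HasSum (fun i => aepRate q ν R L y i • (h (aepMove y i) - h y)) (B (h y)) := by
    intro y hy
    have hs : Summable fun i => aepRate q ν R L y i • (h (aepMove y i) - h y) := by
      refine Summable.of_norm_bounded
        ((summable_aepRate hq0 hq1 hν0 hν1 hR hL y).mul_right (M + M)) fun i => ?_
      have h0 := aepRate_nonneg hq0 hq1 hν0 hν1 hR hL y i
      rw [norm_smul, Real.norm_of_nonneg h0]
      refine mul_le_mul_of_nonneg_left ((norm_sub_le _ _).trans (add_le_add ?_ ?_)) h0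
      · exact hhb c _ (hclosed y hy i)
      · exact hhb c y hy
    convert hs.hasSum using 1
    ext n'
    have h1 := (BoundedContinuousFunction.evalCLM ℝ n').hasSum hs.hasSum
    have h2 : (h y : Weyl k → ℝ) = fun n' : Weyl k => dualH q y n'.occ := funext (hh y)
    rw [hB, h2, genWeyl_dualH hq0 hq1 hν0 hν1,
      genAEP_eq_tsum hq0 hq1 hν0 hν1 hR hL y (C := M) fun i =>
        abs_dualH_le hq0 hq1 (hclosed y hy i) n']
    refine Eq.trans (tsum_congr fun i => ?_) h1.tsum_eq
    simp [hh]
  have hw : SolvesBackward (genAEP q ν R L) {y | ExclConfig.HasTail c y} t (K * M)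
      (fun s y => semigroup B s (h y) n)
      (fun s y => semigroup B s (B (h y)) n) :=
    { bound := fun s hs y hy => hbound s hs y hy
      hasDerivAt := fun y s => hasDerivAt_semigroup_coe B (h y) n s
      continuous := fun y => continuous_iff_continuousAt.2 fun s =>
        (hasDerivAt_semigroup_coe B (B (h y)) n s).continuousAt
      eq := fun y hy s hs => by
        rw [hmoves.exitRate_mul_integral_sub y (fun y => semigroup B s (h y) n) fun i =>
          hbound s hs _ (hclosed y hy i)]
        have h1 := ((BoundedContinuousFunction.evalCLM ℝ n).comp
          (semigroup B s)).hasSum (hsum y hy)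
        refine h1.tsum_eq.symm.trans (tsum_congr fun i => ?_)
        simp }
  have h0 : (fun y => semigroup B 0 (h y) n) = fun y => dualH q y n.occ := by
    funext y; rw [semigroup_zero_apply, hh]
  have := hw.expect_eq (by positivity) ht (hmoves.ae_jumpKernel_mem hclosed)
    (fun y _ => hmoves.exitRate_ne_top y) hx
    (tendsto_measure_jumpTime_genAEP hq0 hq1 hν0 hν1 hR hL hx ht)
  simpa only [h0] using this

theorem one_le_abs_exp_sub_exp {a b : ℕ} (hab : a ≠ b) :
    1 ≤ |Real.exp (1 * a) - Real.exp (1 * b)| := by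
  wlog h : a < b generalizing a b with H
  · rw [abs_sub_comm]
    exact H hab.symm (lt_of_le_of_ne (not_lt.1 h) hab.symm)
  have h1 : Real.exp (1 * a) * 2 ≤ Real.exp (1 * b) := by
    have h2 : ((a : ℝ) + 1) ≤ b := by exact_mod_cast h
    calc Real.exp (1 * a) * 2 ≤ Real.exp (1 * a) * Real.exp 1 :=
          mul_le_mul_of_nonneg_left (by linarith [Real.add_one_le_exp (1 : ℝ)]) (Real.exp_pos _).le
      _ = Real.exp (1 * a + 1) := (Real.exp_add _ _).symm
      _ ≤ _ := Real.exp_le_exp.2 (by linarith)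
  have h3 : 1 ≤ Real.exp (1 * a) := Real.one_le_exp (by positivity)
  rw [abs_sub_comm]
  exact le_trans (by linarith) (le_abs_self _)

/-- The zero-range semigroup solves the true evolution equation. -/
theorem solvesTrueEvolution_semigroup {B : (Weyl k →ᵇ ℝ) →L[ℝ] (Weyl k →ᵇ ℝ)}
    (hB : ∀ h n, B h n = genWeyl q ν R L h n) (v : Weyl k →ᵇ ℝ) {u : ℝ → Weyl k → ℝ}
    (hu : ∀ t, 0 ≤ t → ∀ n, u t n = semigroup B t v n) :
    SolvesTrueEvolution q ν R L u v where
  deriv n t ht := by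
    have h1 := (hasDerivAt_semigroup_coe B v n t).hasDerivWithinAt (s := Ici 0)
    rw [semigroup_apply_comm, hB] at h1
    have h2 : u t = (semigroup B t v : Weyl k → ℝ) := funext (hu t ht)
    rw [h2]
    exact h1.congr (fun s hs => hu s hs n) (hu t ht n)
  initial n := by
    have h1 := (hasDerivAt_semigroup_coe B v n 0).continuousAt.tendsto
    rw [semigroup_zero_apply] at h1
    refine (h1.mono_left nhdsWithin_le_nhds).congr' ?_
    filter_upwards [self_mem_nhdsWithin] with t ht
    exact (hu t (le_of_lt ht) n).symm
  growth T _ := by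
    obtain ⟨K, hK0, hK⟩ := exists_abs_semigroup_le B T
    have hM0 : 0 ≤ K * ‖v‖ := by positivity
    have hb : ∀ (n : Weyl k) (t : ℝ), t ∈ Icc 0 T → |u t n| ≤ K * ‖v‖ := fun n t ht => by
      rw [hu t ht.1]; exact hK t ht v n
    -- the summand `1` only makes the constant positive
    refine ⟨1, 2 * (K * ‖v‖) + 1, one_pos, by positivity, fun n t ht => ?_,
      fun n n' t ht hn => ?_⟩
    · have h1 : 1 ≤ Real.exp (1 * n.size) := Real.one_le_exp (by positivity)
      calc |u t n| ≤ 2 * (K * ‖v‖) + 1 := (hb n t ht).trans (by linarith)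
        _ ≤ _ := le_mul_of_one_le_right (by positivity) h1
    · calc |u t n - u t n'| ≤ 2 * (K * ‖v‖) + 1 := by
            refine (abs_sub _ _).trans ?_
            linarith [hb n t ht, hb n' t ht]
        _ ≤ _ := le_mul_of_one_le_right (by positivity) (one_le_abs_exp_sub_exp hn)

end Semigroup

end QHahn

end

theorem corollary3p7 (q ν R L : ℝ) (hq0 : 0 < q) (hq1 : q < 1) (hν0 : 0 ≤ ν) (hν1 : ν < 1)
    (hR : 0 ≤ R) (hL : 0 ≤ L) (k : ℕ) :
    (∀ x : QHahn.ExclConfig,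
      QHahn.SolvesTrueEvolution q ν R L
        (fun (t : ℝ) (n : QHahn.Weyl k) =>
          QHahn.expect (QHahn.genAEP q ν R L) x t (fun x' => QHahn.dualH q x' n.occ))
        (fun n : QHahn.Weyl k => QHahn.dualH q x n.occ)) ∧
    (∀ (x : QHahn.ExclConfig) (n : QHahn.Weyl k) (t : ℝ), 0 ≤ t →
      Integrable (QHahn.observe (QHahn.genAEP q ν R L) t (fun x' => QHahn.dualH q x' n.occ))
        (QHahn.chainLaw (QHahn.genAEP q ν R L) x) ∧
      Integrable
        (QHahn.observe (QHahn.genWeyl q ν R L) t (fun n' : QHahn.Weyl k => QHahn.dualH q x n'.occ))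
        (QHahn.chainLaw (QHahn.genWeyl q ν R L) n) ∧
      QHahn.expect (QHahn.genAEP q ν R L) x t (fun x' => QHahn.dualH q x' n.occ) =
        QHahn.expect (QHahn.genWeyl q ν R L) n t (fun n' => QHahn.dualH q x n'.occ)) := by
  obtain ⟨B, hB⟩ := QHahn.exists_clm_genWeyl hq0 hq1 hν0 hν1 hR hL k
  obtain ⟨h, hh, hhb⟩ := QHahn.exists_bcf_dualH hq0 hq1 k
  have hcoe : ∀ x, (fun n : QHahn.Weyl k => QHahn.dualH q x n.occ) = h x := fun x =>
    (funext (hh x)).symm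
  have hA := fun x n t (ht : 0 ≤ t) =>
    QHahn.expect_genAEP hq0 hq1 hν0 hν1 hR hL hB hh hhb x n ht
  refine ⟨fun x => ?_, fun x n t ht => ?_⟩
  · rw [hcoe]
    exact QHahn.solvesTrueEvolution_semigroup hB (h x) fun t ht n => (hA x n t ht).2
  · have hW := QHahn.expect_genWeyl hq0 hq1 hν0 hν1 hR hL hB (h x) n ht
    rw [hcoe]
    exact ⟨(hA x n t ht).1, hW.1, (hA x n t ht).2.trans hW.2.symm⟩
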